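/- Let $\mathrm{RM}(d,n)$ be the set of functions $\mathbb F_2^n\to\mathbb F_2$ that are evaluations of polynomials of degree at most $d$. For $f,g:\mathbb F_2^n\to\mathbb F_2$ let $\delta(f,g)=\Pr_{x}[f(x)\ne g(x)]$ with $x$ uniform in $\mathbb F_2^n$, and let $\delta_d(f)=\min_{g\in \mathrm{RM}(d,n)}\delta(f,g)$. For $n\ge d+1$ let $T_{\mathrm{GN}}$ be the test that, given oracle access to $f$, picks a uniformly random $(d+1)$-dimensional affine subspace $A\subseteq\mathbb F_2^n$, queries $f$ on $A$, and accepts if and only if $f|_A$ is a polynomial of degree at most $d$. Theorem 3. The test $T_{\mathrm{GN}}$, repeated a constant number of times, is a tolerant tester for $\mathrm{RM}(d,n)$. That is, there are absolute constants $r\in\mathbb N$, $r\geq 1$, and $c_1,c_2>0$ such that for all integers $d\ge 0$ and $n\ge d+1$ the following holds. The code $\mathrm{RM}(d,n)$ has minimum relative distance $\delta_{\min}=2^{-d}$; and the tester that makes $r$ independent invocations of $T_{\mathrm{GN}}$ and accepts if and only if all of them accept makes at most $r\cdot 2^{d+1}=O(2^d)$ queries and, for every $f:\mathbb F_2^n\to\mathbb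 F_2$, - if $\delta_d(f)\le c_1\,\delta_{\min} = c_1 2^{-d}$, it accepts $f$ with probability at least $2/3$; - if $\delta_d(f)\ge c_2\,\delta_{\min} = c_2 2^{-d}$, it rejects $f$ with probability at least $2/3$. -/

import Mathlib

namespace RMTest

/-- The space `F_2^n`. -/
abbrev Cube (n : ℕ) : Type := Fin n → ZMod 2

/-- The probability of the event `E` under a uniformly random element of the finite type `Ω`. -/
noncomputable def prob {Ω : Type} (E : Ω → Prop) : ℝ :=
  (Nat.card {ω : Ω // E ω} : ℝ) / (Nat.card Ω : ℝ)

/-- Fractional Hamming distance `δ(f, g) = Pr_x [f x ≠ g x]`. -/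
noncomputable def relDist {n : ℕ} (f g : Cube n → ZMod 2) : ℝ :=
  prob (fun x : Cube n => f x ≠ g x)

/-- `δ(f, C) = min {δ(f, g) | g ∈ C}`, for a (nonempty) family `C` of functions. -/
noncomputable def distTo {n : ℕ} (f : Cube n → ZMod 2) (C : Set (Cube n → ZMod 2)) : ℝ :=
  sInf {δ : ℝ | ∃ g ∈ C, δ = relDist f g}

/-- The minimum relative distance of a code `C` (with at least two codewords). -/
noncomputable def minDist {n : ℕ} (C : Set (Cube n → ZMod 2)) : ℝ :=
  sInf {δ : ℝ | ∃ f ∈ C, ∃ g ∈ C, f ≠ g ∧ δ = relDist f g}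

/-- A function given on a set `A ⊆ F_2^n` is (the restriction to `A` of) a polynomial of degree
at most `d`. -/
def IsPolyOn {n : ℕ} (d : ℕ) (A : Set (Cube n)) (g : A → ZMod 2) : Prop :=
  ∃ p : MvPolynomial (Fin n) (ZMod 2), p.totalDegree ≤ d ∧ ∀ x : A, g x = MvPolynomial.eval x.1 p

/-- The Reed-Muller code `RM(d, n)`: the functions `F_2^n → F_2` that are evaluations of
polynomials of degree at most `d`. -/
def RM (d n : ℕ) : Set (Cube n → ZMod 2) :=
  {f | ∃ p : MvPolynomial (Fin n) (ZMod 2), p.totalDegree ≤ d ∧ ∀ x, f x = MvPolynomial.eval x p}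

/-- The `k`-flats of `F_2^n`: the nonempty affine subspaces of dimension `k`. -/
def Flat (n k : ℕ) : Type :=
  {A : AffineSubspace (ZMod 2) (Cube n) //
    (A : Set (Cube n)).Nonempty ∧ Module.finrank (ZMod 2) A.direction = k}

instance instFiniteFlat (n k : ℕ) : Finite (Flat n k) := by
  have : Finite (AffineSubspace (ZMod 2) (Cube n)) :=
    Finite.of_injective (fun A => (A : Set (Cube n))) SetLike.coe_injective
  exact Subtype.finite

theorem nonempty_flat {n k : ℕ} (h : k ≤ n) : Nonempty (Flat n k) := by
  obtain ⟨b, hb⟩ : ∃ b : Fin k → Cube n, LinearIndependent (ZMod 2) b :=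
    ⟨_, (Pi.basisFun (ZMod 2) (Fin n)).linearIndependent.comp _ (Fin.castLE_injective h)⟩
  refine ⟨⟨(Submodule.span (ZMod 2) (Set.range b)).toAffineSubspace, ⟨0, ?_⟩, ?_⟩⟩
  · simp
  · rw [Submodule.toAffineSubspace_direction]
    simpa using finrank_span_eq_card hb

/-- A (nonadaptive) randomized oracle tester for functions `F_2^n → F_2`. It tosses uniform coins
`ω`, reads the oracle on the set `queries ω`, and accepts or rejects as a function of `ω` and of
the values that it has read. -/
structure Tester (n : ℕ) where
  Coins : Type
  finite_coins : Finite Coins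
  nonempty_coins : Nonempty Coins
  queries : Coins → Set (Cube n)
  accepts : (ω : Coins) → (queries ω → ZMod 2) → Prop

namespace Tester

variable {n : ℕ}

/-- The tester `T` accepts with oracle `f` and coins `ω`. -/
def AcceptsOn (T : Tester n) (f : Cube n → ZMod 2) (ω : T.Coins) : Prop :=
  T.accepts ω (fun x => f x.1)

/-- `Pr [T^f accepts]`. -/
noncomputable def acceptProb (T : Tester n) (f : Cube n → ZMod 2) : ℝ :=
  prob (fun ω : T.Coins => T.AcceptsOn f ω)

/-- `Pr [T^f rejects]`. -/
noncomputable def rejectProb (T : Tester n) (f : Cube n → ZMod 2) : ℝ :=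
  prob (fun ω : T.Coins => ¬ T.AcceptsOn f ω)

/-- `T` always queries at most `q` values of the oracle. -/
def QueriesAtMost (T : Tester n) (q : ℕ) : Prop :=
  ∀ ω : T.Coins, (T.queries ω).ncard ≤ q

/-- `r` independent invocations of `T`, accepting iff all of them accept. -/
def rep (T : Tester n) (r : ℕ) : Tester n where
  Coins := Fin r → T.Coins
  finite_coins := by
    have := T.finite_coins
    exact Pi.finite
  nonempty_coins := by
    have := T.nonempty_coins
    exact Pi.instNonempty
  queries ω := ⋃ i, T.queries (ω i)
  accepts ω g := ∀ i, T.accepts (ω i) (fun x => g ⟨x.1, Set.mem_iUnion.2 ⟨i, x.2⟩⟩)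

/-- `T` satisfies the two conditions of a tolerant tester for the code `C` with the constants
`c₁` and `c₂`: it accepts every function within distance `c₁ * δ_min` of `C` with probability at
least `2/3`, and rejects every function at distance at least `c₂ * δ_min` from `C` with probability
at least `2/3`, where `δ_min` is the minimum relative distance of `C`. -/
def IsTolerant (T : Tester n) (C : Set (Cube n → ZMod 2)) (c₁ c₂ : ℝ) : Prop :=
  ∀ f : Cube n → ZMod 2,
    (distTo f C ≤ c₁ * minDist C → 2 / 3 ≤ T.acceptProb f) ∧
    (c₂ * minDist C ≤ distTo f C → 2 / 3 ≤ T.rejectProb f)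

end Tester

/-- The `k`-flat test `T_{d,k}`: pick a uniformly random `k`-flat `A` of `F_2^n` and accept iff
the restriction of the oracle to `A` is a polynomial of degree at most `d`. -/
def flatTest (d : ℕ) {n k : ℕ} (h : k ≤ n) : Tester n where
  Coins := Flat n k
  finite_coins := instFiniteFlat n k
  nonempty_coins := nonempty_flat h
  queries A := (A.1 : Set (Cube n))
  accepts A g := IsPolyOn d (A.1 : Set (Cube n)) g

/-- The test `T_GN = T_{d,d+1}`. -/
def TGN {d n : ℕ} (h : d + 1 ≤ n) : Tester n := flatTest d h

end RMTest

/-! Acceptance near the code is a union bound: every point of a random flat is uniform, so `TGN`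
rejects with probability at most 2^(d+1) δ_d(f) (`rejectProb_le`), which is O(1/r) for a suitable
c₁.

For rejection it suffices that functions at distance at least 2^(-d)/32 are rejected with
probability at least 4^(-9) (`rej_ge_of_far`); r is then a constant. Degree at most d means that all
(d+1)-fold derivatives vanish, equivalently that all sums over parallelepipeds with d+1 edges
vanish. The probability `rej` of a nonzero sum on a random parallelepiped bounds the rejection
probability from below.

The bound on `rej` is an induction on the dimension d+8+j through restrictions to affine hyperplanes
(`rej_ge_of_far_of_finrank`). If only O(2^d) hyperplanes carry a restriction close to degree d, the
induction hypothesis applies on all others, and averaging loses a factor 1 - O(2^(-j)); the product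
of these factors stays bounded below. If more hyperplanes do, their approximations glue to one
global P of degree d (`exists_close_of_many_hyperplanes`). Then f is at distance between 2^(-d)/32
and 2^(-d)/8 from P, and a second moment bound gives constant rejection (`rej_ge_of_close`). The
induction starts from `rej_ge_of_not_degLT`: a function not of degree d is rejected with probability
that decays only with the codimension. -/

namespace RMTest

open Finset
open scoped Classical

set_option linter.unusedSectionVars false

/-! ### Degree through derivatives and parallelepiped sums. -/

section Degree

variable {V W : Type} [AddCommGroup V] [Module (ZMod 2) V] [AddCommGroup W] [Module (ZMod 2) W]

/-- `DegLT k f` says that `f` has degree less than `k`: all its `k`-fold derivatives vanish. -/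
def DegLT : ℕ → (V → ZMod 2) → Prop
  | 0, f => ∀ x, f x = 0
  | k + 1, f => ∀ v, DegLT k (fun x => f (x + v) + f x)

/-- The sum of `f` over the parallelepiped at `a` with edges `v`, with multiplicity. -/
def cubeSum {k : ℕ} (f : V → ZMod 2) (a : V) (v : Fin k → V) : ZMod 2 :=
  ∑ t : Fin k → ZMod 2, f (a + ∑ i, t i • v i)

theorem zmod_two_cases (z : ZMod 2) : z = 0 ∨ z = 1 := by
  revert z; decide

theorem DegLT.zero (k : ℕ) : DegLT k (fun _ : V => 0) := by
  induction k with
  | zero => intro x; rfl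
  | succ k ih => intro v; simpa using ih

theorem DegLT.add {k : ℕ} {f g : V → ZMod 2} (hf : DegLT k f) (hg : DegLT k g) :
    DegLT k (fun x => f x + g x) := by
  induction k generalizing f g with
  | zero => intro x; simp [hf x, hg x]
  | succ k ih =>
    intro v
    have := ih (hf v) (hg v)
    convert this using 2
    ring

theorem DegLT.succ {k : ℕ} {f : V → ZMod 2} (hf : DegLT k f) : DegLT (k + 1) f := by
  induction k generalizing f with
  | zero => intro v x; simp [hf x, hf (x + v)]
  | succ k ih => intro v; exact ih (hf v)

theorem DegLT.mono {k m : ℕ} (h : k ≤ m) {f : V → ZMod 2} (hf : DegLT k f) : DegLT m f := by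
  induction h with
  | refl => exact hf
  | step _ ih => exact ih.succ

theorem DegLT.comp {k : ℕ} {f : W → ZMod 2} (hf : DegLT k f) {φ L : V → W}
    (hφ : ∀ x v, φ (x + v) = φ x + L v) : DegLT k (fun x => f (φ x)) := by
  induction k generalizing f with
  | zero => intro x; exact hf _
  | succ k ih =>
    intro v
    have := ih (hf (L v))
    simpa only [hφ] using this

theorem DegLT.translate {k : ℕ} {f : V → ZMod 2} (hf : DegLT k f) (u : V) :
    DegLT k (fun x => f (x + u)) :=
  hf.comp (φ := fun x => x + u) (L := id) (fun x v => by simp; abel)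

theorem DegLT.const (c : ZMod 2) : DegLT 1 (fun _ : V => c) := by
  intro v x; exact CharTwo.add_self_eq_zero c

theorem DegLT.affine_mul {k : ℕ} {f : V → ZMod 2} (hf : DegLT k f)
    (l : Module.Dual (ZMod 2) V) (c : ZMod 2) : DegLT (k + 1) (fun x => (l x + c) * f x) := by
  induction k generalizing f c with
  | zero => intro v x; simp [hf x, hf (x + v)]
  | succ k ih =>
    intro v
    have h1 := ih (hf v) c
    have h2 : DegLT (k + 1) (fun x => l v * f (x + v)) := by
      rcases zmod_two_cases (l v) with h | h
      · simpa [h] using DegLT.zero (V := V) (k + 1)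
      · simpa [h] using hf.translate v
    have h3 := h1.add h2
    convert h3 using 2 with x
    simp only [map_add]
    ring

theorem cubeSum_cons {k : ℕ} (f : V → ZMod 2) (a w : V) (v : Fin k → V) :
    cubeSum f a (Fin.cons w v : Fin (k + 1) → V) =
      cubeSum (fun x => f (x + w) + f x) a v := by
  unfold cubeSum
  rw [← (Fin.consEquiv (fun _ : Fin (k + 1) => ZMod 2)).sum_comp, Fintype.sum_prod_type]
  have h2 : ∀ F : ZMod 2 → ZMod 2, ∑ x : ZMod 2, F x = F 1 + F 0 := by
    intro F
    have : (univ : Finset (ZMod 2)) = {1, 0} := by decide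
    rw [this]; simp
  rw [h2, ← sum_add_distrib]
  refine sum_congr rfl fun t _ => ?_
  simp only [Fin.consEquiv_apply, Fin.sum_univ_succ, Fin.cons_zero, Fin.cons_succ, one_smul,
    zero_smul, zero_add]
  rw [show a + (w + ∑ i, t i • v i) = a + ∑ i, t i • v i + w by abel]

theorem degLT_iff_cubeSum {k : ℕ} {f : V → ZMod 2} :
    DegLT k f ↔ ∀ (a : V) (v : Fin k → V), cubeSum f a v = 0 := by
  induction k generalizing f with
  | zero =>
    have : ∀ (a : V) (v : Fin 0 → V), cubeSum f a v = f a := by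
      intro a v; simp [cubeSum]
    simp only [this, DegLT, forall_const]
  | succ k ih =>
    constructor
    · intro h a v
      have := (ih.1 (h (v 0))) a (Fin.tail v)
      rw [← cubeSum_cons, Fin.cons_self_tail] at this
      exact this
    · intro h w
      refine ih.2 fun a v => ?_
      rw [← cubeSum_cons]
      exact h _ _

/-- A linear relation `s` among the edges makes `t ↦ t + s` a fixed-point-free involution of the
corners that keeps the point, so terms cancel in pairs. -/
theorem cubeSum_eq_zero_of_not_linearIndependent {k : ℕ} (f : V → ZMod 2) (a : V)
    {v : Fin k → V} (hv : ¬ LinearIndependent (ZMod 2) v) : cubeSum f a v = 0 := by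
  obtain ⟨s, hs, i, hi⟩ := Fintype.not_linearIndependent_iff.1 hv
  unfold cubeSum
  refine sum_involution (fun t _ => t + s) ?_ ?_ ?_ ?_
  · intro t _
    simp only [Pi.add_apply, add_smul, sum_add_distrib, hs, add_zero]
    exact CharTwo.add_self_eq_zero _
  · intro t _ _ h
    exact hi (by simpa using congrFun h i)
  · intro t _; exact mem_univ _
  · intro t _
    funext j
    simp only [Pi.add_apply, add_assoc, CharTwo.add_self_eq_zero, add_zero]

theorem cubeSum_add {k : ℕ} (f g : V → ZMod 2) (a : V) (v : Fin k → V) :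
    cubeSum (fun x => f x + g x) a v = cubeSum f a v + cubeSum g a v :=
  sum_add_distrib

theorem cubeSum_eq_sum [Fintype V] {k : ℕ} (f : V → ZMod 2) (a : V) {v : Fin k → V}
    (hv : LinearIndependent (ZMod 2) v) (hk : Module.finrank (ZMod 2) V = k) :
    cubeSum f a v = ∑ x, f x := by
  have hinj : Function.Injective (fun t : Fin k → ZMod 2 => a + ∑ i, t i • v i) := by
    intro s t h
    exact hv.fintypeLinearCombination_injective (by
      simpa [Fintype.linearCombination_apply] using h)
  have hcard : Fintype.card (Fin k → ZMod 2) = Fintype.card V := by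
    rw [Module.card_eq_pow_finrank (K := ZMod 2) (V := V), hk]; simp
  have hbij := (Fintype.bijective_iff_injective_and_card _).2 ⟨hinj, hcard⟩
  exact hbij.sum_comp f

/-- In dimension `k` a nondegenerate parallelepiped with `k` edges is the whole space, so a single
sum decides. -/
theorem degLT_finrank_of_sum_eq_zero [Fintype V] {k : ℕ} (h : Module.finrank (ZMod 2) V = k)
    {f : V → ZMod 2} (hf : ∑ x, f x = 0) : DegLT k f := by
  refine degLT_iff_cubeSum.2 fun a v => ?_
  by_cases hv : LinearIndependent (ZMod 2) v
  · rw [cubeSum_eq_sum f a hv h, hf]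
  · exact cubeSum_eq_zero_of_not_linearIndependent f a hv

theorem DegLT.sum_eq_zero [Fintype V] {k : ℕ} (h : k ≤ Module.finrank (ZMod 2) V)
    {f : V → ZMod 2} (hf : DegLT k f) : ∑ x, f x = 0 := by
  have hb := (Module.finBasis (ZMod 2) V).linearIndependent
  rw [← cubeSum_eq_sum f 0 hb rfl]
  exact degLT_iff_cubeSum.1 (hf.mono h) _ _

/-- A nonzero function of degree at most `d` is nonzero on at least a `2⁻ᵈ` fraction. -/
theorem DegLT.card_le_two_pow_mul [Fintype V] {d : ℕ} {f : V → ZMod 2} (hf : DegLT (d + 1) f)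
    (hne : ∃ x, f x ≠ 0) :
    Fintype.card V ≤ 2 ^ d * (univ.filter fun x => f x ≠ 0).card := by
  induction d generalizing f with
  | zero =>
    obtain ⟨x, hx⟩ := hne
    have hall : ∀ y, f y ≠ 0 := by
      intro y
      have := hf (y - x) x
      simp only [add_sub_cancel] at this
      rw [CharTwo.add_eq_zero] at this
      rwa [this]
    rw [filter_true_of_mem (fun y _ => hall y)]
    simp
  | succ d ih =>
    -- A nonzero derivative has lower degree, and its support lies in the union of the support of
    -- `f` and a translate of it; this costs the factor 2.
    by_cases hd : ∃ v x, f (x + v) + f x ≠ 0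
    · obtain ⟨v, hv⟩ := hd
      refine (ih (hf v) hv).trans ?_
      rw [pow_succ, mul_assoc]
      refine Nat.mul_le_mul_left _ ?_
      have hsub : (univ.filter fun x => f (x + v) + f x ≠ 0) ⊆
          (univ.filter fun x => f (x + v) ≠ 0) ∪ (univ.filter fun x => f x ≠ 0) := by
        intro x
        simp only [mem_filter, mem_univ, true_and, mem_union]
        intro h
        by_contra! hc
        exact h (by simp [hc.1, hc.2])
      have hcard : (univ.filter fun x => f (x + v) ≠ 0).card =
          (univ.filter fun x => f x ≠ 0).card :=
        card_equiv (Equiv.addRight v) (by simp)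
      have := (card_le_card hsub).trans (card_union_le _ _)
      omega
    · push Not at hd
      have h1 : DegLT (0 + 1) f := fun v x => hd v x
      have h2 : DegLT (d + 1) f := h1.mono (by omega)
      refine (ih h2 hne).trans ?_
      exact Nat.mul_le_mul_right _ (Nat.pow_le_pow_right (by norm_num) (by omega))

/-- A function of degree less than `S.card` on the hyperplane `l = b` that vanishes on its
intersections with `S.card` transversal hyperplanes is zero there. -/
theorem DegLT.eq_zero_of_vanishes {ι : Type} [DecidableEq ι] {S : Finset ι}
    {q : V → ZMod 2} (hq : DegLT S.card q) (l : Module.Dual (ZMod 2) V) (b : ZMod 2)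
    (m : ι → Module.Dual (ZMod 2) V) (c : ι → ZMod 2) (w : ι → V) (hl : ∀ i ∈ S, l (w i) = 0)
    (hm : ∀ i ∈ S, ∀ j ∈ S, m i (w j) = if i = j then 1 else 0)
    (hv : ∀ x, l x = b → (∃ i ∈ S, m i x = c i) → q x = 0) : ∀ x, l x = b → q x = 0 := by
  induction S using Finset.induction_on generalizing q with
  | empty => intro x _; exact hq x
  | insert j S hj ih =>
    rw [card_insert_of_notMem hj] at hq
    -- The derivative along `w j` has lower degree and still vanishes on the other transversal
    -- hyperplanes, hence on all of `l = b`. So `q` is invariant under `w j` there, and one of `x`,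
    -- `x + w j` lies on `m j = c j`.
    have h1 := ih (hq (w j)) (fun i hi => hl i (mem_insert_of_mem hi))
      (fun i hi i' hi' => hm i (mem_insert_of_mem hi) i' (mem_insert_of_mem hi')) (by
        rintro x hx ⟨i, hi, hix⟩
        have hij : i ≠ j := fun h => hj (h ▸ hi)
        rw [hv x hx ⟨i, mem_insert_of_mem hi, hix⟩, hv (x + w j) _ ⟨i, mem_insert_of_mem hi, _⟩]
        · simp
        · rw [map_add, hx, hl j (mem_insert_self _ _), add_zero]
        · rw [map_add, hix, hm i (mem_insert_of_mem hi) j (mem_insert_self _ _), if_neg hij,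
            add_zero])
    intro x hx
    by_cases hjx : m j x = c j
    · exact hv x hx ⟨j, mem_insert_self _ _, hjx⟩
    · have h2 := h1 x hx
      rw [hv (x + w j) _ ⟨j, mem_insert_self _ _, _⟩, zero_add] at h2
      · exact h2
      · rw [map_add, hx, hl j (mem_insert_self _ _), add_zero]
      · rw [map_add, hm j (mem_insert_self _ _) j (mem_insert_self _ _), if_pos rfl]
        revert hjx
        generalize m j x = y
        generalize c j = z
        revert y z
        decide

end Degree

/-! ### Gluing low-degree approximations on many hyperplanes. -/

section Interpolation

variable {V : Type} [AddCommGroup V] [Module (ZMod 2) V]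

/-- A surjective homomorphism carries the uniform distribution to the uniform one; averaging over
translates shows it without counting fibres. -/
theorem card_mul_sum_comp {A B : Type} [AddCommGroup A] [AddCommGroup B] [Fintype A] [Fintype B]
    (φ : A →+ B) (hφ : Function.Surjective φ) (h : B → ℝ) :
    (Fintype.card B : ℝ) * ∑ a, h (φ a) = Fintype.card A * ∑ b, h b := by
  have h1 : ∀ b, ∑ a, h (φ a) = ∑ a, h (φ a + b) := by
    intro b
    obtain ⟨c, rfl⟩ := hφ b
    rw [← Equiv.sum_comp (Equiv.addRight c)]
    simp
  have h2 : ∀ a, ∑ b, h b = ∑ b, h (φ a + b) := by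
    intro a
    rw [← Equiv.sum_comp (Equiv.addLeft (φ a))]
    simp
  calc (Fintype.card B : ℝ) * ∑ a, h (φ a) = ∑ b, ∑ a, h (φ a + b) := by
        rw [← sum_congr rfl fun b _ => h1 b]; simp
    _ = ∑ a, ∑ b, h (φ a + b) := sum_comm
    _ = _ := by rw [← sum_congr rfl fun a _ => h2 a]; simp

/-- The joint map `LinearMap.pi l` is onto, because a functional vanishing on its range is a linear
relation among the `l i`. -/
theorem exists_dual_vectors {ι : Type} [Fintype ι]
    {l : ι → Module.Dual (ZMod 2) V} (hl : LinearIndependent (ZMod 2) l) :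
    ∃ w : ι → V, ∀ i j, l i (w j) = if i = j then 1 else 0 := by
  have hsurj : LinearMap.range (LinearMap.pi l) = ⊤ := by
    by_contra hne
    obtain ⟨φ, hφ, hker⟩ := Submodule.exists_le_ker_of_lt_top _ (lt_top_iff_ne_top.2 hne)
    apply hφ
    have hsum : ∑ i, φ (Pi.single i 1) • l i = 0 := by
      ext x
      have hx : φ (LinearMap.pi l x) = 0 := hker ⟨x, rfl⟩
      rw [LinearMap.pi_apply_eq_sum_univ φ] at hx
      simp only [LinearMap.pi_apply, smul_eq_mul] at hx
      simp only [LinearMap.sum_apply, LinearMap.smul_apply, smul_eq_mul, LinearMap.zero_apply]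
      rw [← hx]
      refine sum_congr rfl fun i _ => ?_
      rw [mul_comm]
      congr 2
      funext j
      by_cases h : i = j <;> simp [h, eq_comm]
    have hz := Fintype.linearIndependent_iff.1 hl _ hsum
    refine LinearMap.pi_ext' fun i => LinearMap.ext_ring ?_
    simpa using hz i
  rw [LinearMap.range_eq_top] at hsurj
  choose w hw using fun j : ι => hsurj (Pi.single j 1)
  refine ⟨w, fun i j => ?_⟩
  have := congrFun (hw j) i
  simpa [Pi.single_apply] using this

theorem exists_apply_eq_one {l : Module.Dual (ZMod 2) V} (hl : l ≠ 0) : ∃ w, l w = 1 := by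
  by_contra! h
  refine hl (LinearMap.ext fun x => ?_)
  exact (zmod_two_cases (l x)).resolve_right (h x)

/-- Functions of bounded degree on independent hyperplanes that agree on the pairwise
intersections have a common extension. -/
theorem exists_interpolation {ι : Type} [Fintype ι] {k : ℕ}
    {l : ι → Module.Dual (ZMod 2) V} {w : ι → V}
    (hw : ∀ i j, l i (w j) = if i = j then 1 else 0) (b : ι → ZMod 2) (p : ι → V → ZMod 2)
    (hp : ∀ i, DegLT k (p i))
    (hcons : ∀ i j x, l i x = b i → l j x = b j → p i x = p j x) :
    ∃ P, DegLT k P ∧ ∀ i x, l i x = b i → P x = p i x := by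
  suffices h : ∀ S : Finset ι, ∃ P, DegLT k P ∧ ∀ i ∈ S, ∀ x, l i x = b i → P x = p i x by
    obtain ⟨P, h1, h2⟩ := h univ
    exact ⟨P, h1, fun i => h2 i (mem_univ i)⟩
  intro S
  induction S using Finset.induction_on with
  | empty => exact ⟨fun _ => 0, DegLT.zero k, by simp⟩
  | insert j S hj ih =>
    obtain ⟨P, hP, hPS⟩ := ih
    have hproj : ∀ x v : V, (x + v) + (l j (x + v) + b j) • w j =
        (x + (l j x + b j) • w j) + (v + l j v • w j) := by
      intro x v
      rw [map_add, add_smul, add_smul, add_smul]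
      abel
    -- The correction `p j + P` is pulled back along the projection to hyperplane `j` in direction
    -- `w j`. This projection is affine, so the degree is kept; it preserves the earlier
    -- hyperplanes, and there the correction vanishes by `hcons`.
    refine ⟨fun x => P x + (p j (x + (l j x + b j) • w j) + P (x + (l j x + b j) • w j)),
      hP.add (((hp j).add hP).comp (φ := fun x => x + (l j x + b j) • w j)
        (L := fun v => v + l j v • w j) hproj), ?_⟩
    intro i hi x hx
    rcases mem_insert.1 hi with rfl | hi
    · simp only [hx, CharTwo.add_self_eq_zero, zero_smul, add_zero]
      rw [add_comm, add_assoc, CharTwo.add_self_eq_zero, add_zero]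
    · have hij : i ≠ j := fun h => hj (h ▸ hi)
      have h1 : l i (x + (l j x + b j) • w j) = b i := by simp [hw, hij, hx]
      have h2 : l j (x + (l j x + b j) • w j) = b j := by
        simp only [map_add, map_smul, hw, if_true, smul_eq_mul, mul_one]
        rw [← add_assoc, CharTwo.add_self_eq_zero, zero_add]
      simp only []
      rw [hPS i hi _ h1, hcons j i _ h2 h1, CharTwo.add_self_eq_zero, add_zero, hPS i hi x hx]

variable [Fintype V]

noncomputable instance instFintypeDual : Fintype (Module.Dual (ZMod 2) V) := by
  have : Finite (Module.Dual (ZMod 2) V) := DFunLike.finite _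
  exact Fintype.ofFinite _

theorem card_eq_two_pow : Fintype.card V = 2 ^ Module.finrank (ZMod 2) V := by
  rw [Module.card_eq_pow_finrank (K := ZMod 2), ZMod.card]

theorem card_le_four_mul_ker (l m : Module.Dual (ZMod 2) V) :
    Fintype.card V ≤ 4 * Fintype.card (LinearMap.ker (l.prod m)) := by
  have h1 := (l.prod m).finrank_range_add_finrank_ker
  have h2 : Module.finrank (ZMod 2) (LinearMap.range (l.prod m)) ≤ 2 := by
    refine (Submodule.finrank_le _).trans ?_
    simp
  rw [card_eq_two_pow, card_eq_two_pow, show 4 = 2 ^ 2 by rfl, ← pow_add]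
  exact Nat.pow_le_pow_right (by norm_num) (by omega)

/-- A nonempty intersection has at least N/4 points, so a nonzero `p + q` would be nonzero on at
least N/(4·2^d) of them; closeness to `f` allows fewer than N/(32·2^d). -/
theorem eq_on_inter_of_close {d : ℕ} {f p q : V → ZMod 2} (hp : DegLT (d + 1) p)
    (hq : DegLT (d + 1) q) (l m : Module.Dual (ZMod 2) V) (b c : ZMod 2)
    (h1 : 64 * 2 ^ d * (univ.filter fun x => l x = b ∧ f x ≠ p x).card < Fintype.card V)
    (h2 : 64 * 2 ^ d * (univ.filter fun x => m x = c ∧ f x ≠ q x).card < Fintype.card V)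
    (u : V) (hub : l u = b) (huc : m u = c) : p u = q u := by
  by_contra hne
  have hr : DegLT (d + 1) (fun x : LinearMap.ker (l.prod m) => p (u + x) + q (u + x)) :=
    (hp.add hq).comp (φ := fun x : LinearMap.ker (l.prod m) => u + (x : V)) (L := fun x => (x : V))
      (fun x v => by simp [add_assoc])
  have h3 := hr.card_le_two_pow_mul ⟨0, by
    simp only [ZeroMemClass.coe_zero, add_zero]
    intro h
    exact hne (CharTwo.add_eq_zero.1 h)⟩
  have h4 : (univ.filter fun x : LinearMap.ker (l.prod m) => p (u + x) + q (u + x) ≠ 0).card ≤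
      (univ.filter fun x => l x = b ∧ f x ≠ p x).card +
      (univ.filter fun x => m x = c ∧ f x ≠ q x).card := by
    rw [← card_image_of_injective _
      (show Function.Injective (fun x : LinearMap.ker (l.prod m) => u + (x : V)) from
        fun x y h => Subtype.ext (add_left_cancel h))]
    refine (card_le_card ?_).trans (card_union_le _ _)
    intro y hy
    simp only [mem_image, mem_filter, mem_univ, true_and, mem_union] at hy ⊢
    obtain ⟨x, hx, rfl⟩ := hy
    have hxk := x.2
    replace hxk : l (x : V) = 0 ∧ m (x : V) = 0 := Prod.mk_eq_zero.1 hxk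
    rw [map_add, map_add, hub, huc, hxk.1, hxk.2, add_zero, add_zero]
    by_contra! hc
    refine hx ?_
    rw [← hc.1 rfl, ← hc.2 rfl, CharTwo.add_self_eq_zero]
  have h5 := card_le_four_mul_ker l m
  have h6 := Nat.mul_le_mul_left (2 ^ d) h4
  rw [mul_add] at h6
  rw [mul_assoc] at h1 h2
  omega

/-- Each normal serves at most two hyperplanes, so the normals span more than 2^m vectors, that is,
dimension more than `m`. -/
theorem exists_independent_hyperplanes {m : ℕ} (B : Finset (Module.Dual (ZMod 2) V × ZMod 2))
    (hB : 2 ^ (m + 1) < B.card) :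
    ∃ (ι : Type) (_ : Fintype ι) (h : ι → Module.Dual (ZMod 2) V × ZMod 2),
      (∀ i, h i ∈ B) ∧ LinearIndependent (ZMod 2) (fun i => (h i).1) ∧
      m < Fintype.card ι := by
  let s : Finset (Module.Dual (ZMod 2) V) := B.image Prod.fst
  obtain ⟨t, hts, hspan, hind⟩ := exists_linearIndependent (ZMod 2)
    (s : Set (Module.Dual (ZMod 2) V))
  have hmem : ∀ i : t, ∃ h ∈ B, h.1 = i.1 := by
    intro i
    have := hts i.2
    simpa [s] using this
  choose h hB' hfst using hmem
  refine ⟨t, Fintype.ofFinite _, h, hB', ?_, ?_⟩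
  · simpa only [hfst] using hind
  · let : Fintype t := Fintype.ofFinite _
    have h1 : B.card ≤ 2 * s.card := by
      have : B ⊆ s ×ˢ (univ : Finset (ZMod 2)) := fun x hx =>
        mem_product.2 ⟨mem_image_of_mem _ hx, mem_univ _⟩
      have := card_le_card this
      rw [card_product, card_univ, ZMod.card] at this
      omega
    have h2 : s.card ≤ Fintype.card (Submodule.span (ZMod 2) (s : Set (Module.Dual (ZMod 2) V))) := by
      rw [← Fintype.card_coe s]
      exact Fintype.card_le_of_injective (fun x => ⟨x.1, Submodule.subset_span x.2⟩)
        fun x y hxy => Subtype.ext (by simpa using hxy)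
    rw [card_eq_two_pow, ← hspan] at h2
    have h3 : Module.finrank (ZMod 2) (Submodule.span (ZMod 2) t) = Fintype.card t := by
      have := finrank_span_eq_card hind
      rwa [Subtype.range_coe] at this
    rw [h3] at h2
    rw [pow_succ] at hB
    have h4 : 2 ^ m < 2 ^ Fintype.card t := by omega
    exact (Nat.pow_lt_pow_iff_right (by norm_num)).1 h4

/-- `P` interpolates on an independent subfamily of at least `d + 2` hyperplanes. On any `g` in `B`
it agrees with `p g` along `d + 1` transversal intersections, which forces agreement on all of `g`.
-/
theorem exists_common_extension {d : ℕ} (f : V → ZMod 2)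
    (B : Finset (Module.Dual (ZMod 2) V × ZMod 2))
    (p : Module.Dual (ZMod 2) V × ZMod 2 → V → ZMod 2) (hp : ∀ h ∈ B, DegLT (d + 1) (p h))
    (hclose : ∀ h ∈ B,
      64 * 2 ^ d * (univ.filter fun x => h.1 x = h.2 ∧ f x ≠ p h x).card < Fintype.card V)
    (hB : 2 ^ (d + 2) < B.card) :
    ∃ P, DegLT (d + 1) P ∧ ∀ h ∈ B, ∀ x, h.1 x = h.2 → P x = p h x := by
  have hcons : ∀ h ∈ B, ∀ h' ∈ B, ∀ x, h.1 x = h.2 → h'.1 x = h'.2 → p h x = p h' x :=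
    fun h hh h' hh' x hx hx' => eq_on_inter_of_close (hp h hh) (hp h' hh') h.1 h'.1 h.2 h'.2
      (hclose h hh) (hclose h' hh') x hx hx'
  obtain ⟨ι, _, h, hmem, hind, hcard⟩ := exists_independent_hyperplanes B hB
  obtain ⟨w, hw⟩ := exists_dual_vectors hind
  obtain ⟨P, hP, hPi⟩ := exists_interpolation hw (fun i => (h i).2) (fun i => p (h i))
    (fun i => hp _ (hmem i)) (fun i j x => hcons _ (hmem i) _ (hmem j) x)
  refine ⟨P, hP, fun g hg => ?_⟩
  -- One index is sacrificed: `w i + g.1 (w i) • w j` lies in the kernel of `g.1` and stays dual to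
  -- the remaining normals. If `g.1` kills every `w i`, any `j` will do.
  obtain ⟨j, hj⟩ : ∃ j, ∀ i, g.1 (w i) ≠ 0 → g.1 (w j) = 1 := by
    by_cases hex : ∃ j, g.1 (w j) = 1
    · exact ⟨hex.choose, fun _ _ => hex.choose_spec⟩
    · have : 0 < Fintype.card ι := by omega
      refine ⟨(Fintype.card_pos_iff.1 this).some, fun i hi => ?_⟩
      exact absurd ⟨i, (zmod_two_cases _).resolve_left hi⟩ hex
  have hS : d + 1 ≤ (univ.erase j).card := by
    rw [card_erase_of_mem (mem_univ j), card_univ]; omega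
  have key := DegLT.eq_zero_of_vanishes (S := univ.erase j) (q := fun x => P x + p g x)
    ((hP.add (hp g hg)).mono hS) g.1 g.2 (fun i => (h i).1) (fun i => (h i).2)
    (fun i => w i + g.1 (w i) • w j) ?_ ?_ ?_
  · intro x hx
    exact CharTwo.add_eq_zero.1 (key x hx)
  · intro i _
    rcases zmod_two_cases (g.1 (w i)) with h0 | h1
    · simp [h0]
    · rw [map_add, map_smul, hj i (by simp [h1]), h1]
      decide
  · intro i hi i' _
    have : i ≠ j := (mem_erase.1 hi).1
    rw [map_add, map_smul, hw, hw, if_neg this, smul_zero, add_zero]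
  · rintro x hx ⟨i, _, hi⟩
    rw [hPi i x hi, hcons _ (hmem i) g hg x hi hx, CharTwo.add_self_eq_zero]

theorem two_mul_card_hyperplane {l : Module.Dual (ZMod 2) V} (hl : l ≠ 0) (b : ZMod 2) :
    (2 : ℝ) * (univ.filter fun x => l x = b).card = Fintype.card V := by
  have hs : Function.Surjective l.toAddMonoidHom := by
    obtain ⟨w, hw⟩ := exists_apply_eq_one hl
    intro c
    exact ⟨c • w, by simp [hw]⟩
  have := card_mul_sum_comp l.toAddMonoidHom hs (fun c => if c = b then 1 else 0)
  rw [sum_ite_eq' univ b, if_pos (mem_univ b), mul_one, ZMod.card] at this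
  rw [card_filter]
  push_cast
  exact this

theorem four_mul_card_inter_hyperplanes {h h' : Module.Dual (ZMod 2) V × ZMod 2}
    (h0 : h.1 ≠ 0) (h0' : h'.1 ≠ 0) (hne : h ≠ h') :
    (4 : ℝ) * (univ.filter fun x => h.1 x = h.2 ∧ h'.1 x = h'.2).card ≤ (Fintype.card V : ℝ) := by
  by_cases hl : h.1 = h'.1
  · have : (univ.filter fun x => h.1 x = h.2 ∧ h'.1 x = h'.2) = ∅ := by
      refine filter_eq_empty_iff.2 fun x _ hx => hne (Prod.ext hl ?_)
      rw [← hx.1, ← hx.2, hl]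
    rw [this]; simp
  · have hind : LinearIndependent (ZMod 2) ![h.1, h'.1] := by
      rw [LinearIndependent.pair_iff]
      intro s t hst
      rcases zmod_two_cases s with rfl | rfl <;> rcases zmod_two_cases t with rfl | rfl
      · simp
      · simp [h0'] at hst
      · simp [h0] at hst
      · exfalso
        refine hl (LinearMap.ext fun x => ?_)
        have := LinearMap.congr_fun hst x
        simp only [one_smul, LinearMap.add_apply, LinearMap.zero_apply] at this
        exact CharTwo.add_eq_zero.1 this
    obtain ⟨w, hw⟩ := exists_dual_vectors hind
    have hs : Function.Surjective (h.1.prod h'.1).toAddMonoidHom := by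
      rintro ⟨c, c'⟩
      refine ⟨c • w 0 + c' • w 1, ?_⟩
      have h00 := hw 0 0
      have h01 := hw 0 1
      have h10 := hw 1 0
      have h11 := hw 1 1
      simp at h00 h01 h10 h11
      simp [h00, h01, h10, h11]
    have := card_mul_sum_comp (h.1.prod h'.1).toAddMonoidHom hs
      (fun c => if c = (h.2, h'.2) then 1 else 0)
    rw [sum_ite_eq' univ (h.2, h'.2), if_pos (mem_univ _), mul_one, Fintype.card_prod,
      ZMod.card] at this
    rw [card_filter, ← this]
    refine le_of_eq ?_
    push_cast
    congr 1
    norm_num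

/-- For a random point the incidence indicators have mean 1/2, variance 1/4 and nonpositive
covariances (parallel hyperplanes are disjoint, others independent). -/
theorem card_incidence_sq_le (B : Finset (Module.Dual (ZMod 2) V × ZMod 2))
    (hB0 : ∀ h ∈ B, h.1 ≠ 0) :
    ∑ x : V, ((∑ h ∈ B, if h.1 x = h.2 then (1 : ℝ) else 0) - (B.card : ℝ) / 2) ^ 2 ≤
      (Fintype.card V : ℝ) * B.card / 4 := by
  set N : ℝ := ((Fintype.card V : ℕ) : ℝ)
  set K : ℝ := ((B.card : ℕ) : ℝ)
  have h1 : ∑ x : V, ∑ h ∈ B, (if h.1 x = h.2 then (1 : ℝ) else 0) = K * (N / 2) := by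
    rw [sum_comm, sum_congr rfl (g := fun _ => N / 2)]
    · simp [K]
    · intro h hh
      have := two_mul_card_hyperplane (hB0 h hh) h.2
      rw [card_filter] at this
      push_cast at this
      linarith
  have h2 : ∑ x : V, (∑ h ∈ B, if h.1 x = h.2 then (1 : ℝ) else 0) ^ 2 ≤
      K * (N / 4 + K * (N / 4)) := by
    have e1 : ∀ x : V, (∑ h ∈ B, if h.1 x = h.2 then (1 : ℝ) else 0) ^ 2 =
        ∑ h ∈ B, ∑ h' ∈ B, if h.1 x = h.2 ∧ h'.1 x = h'.2 then (1 : ℝ) else 0 := by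
      intro x
      rw [sq, sum_mul_sum]
      refine sum_congr rfl fun h _ => sum_congr rfl fun h' _ => ?_
      rw [ite_and]
      split_ifs <;> simp
    rw [sum_congr rfl fun x _ => e1 x, sum_comm]
    have e2 : ∀ h ∈ B, ∑ x : V, ∑ h' ∈ B,
        (if h.1 x = h.2 ∧ h'.1 x = h'.2 then (1 : ℝ) else 0) ≤ N / 4 + K * (N / 4) := by
      intro h hh
      rw [sum_comm]
      have e3 : ∀ h' ∈ B, ∑ x : V, (if h.1 x = h.2 ∧ h'.1 x = h'.2 then (1 : ℝ) else 0) ≤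
          (if h' = h then N / 4 else 0) + N / 4 := by
        intro h' hh'
        by_cases heq : h' = h
        · subst heq
          have := two_mul_card_hyperplane (hB0 h' hh) h'.2
          rw [card_filter] at this
          push_cast at this
          simp only [and_self, if_true]
          linarith
        · have := four_mul_card_inter_hyperplanes (hB0 h hh) (hB0 h' hh') (Ne.symm heq)
          rw [card_filter] at this
          push_cast at this
          rw [if_neg heq]
          linarith
      refine (sum_le_sum e3).trans ?_
      rw [sum_add_distrib, sum_ite_eq', if_pos hh]
      simp [K]
    refine (sum_le_sum e2).trans ?_
    rw [sum_const, nsmul_eq_mul]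
  have h3 : ∀ x : V, ((∑ h ∈ B, if h.1 x = h.2 then (1 : ℝ) else 0) - K / 2) ^ 2 =
      (∑ h ∈ B, if h.1 x = h.2 then (1 : ℝ) else 0) ^ 2 -
      K * (∑ h ∈ B, if h.1 x = h.2 then (1 : ℝ) else 0) + K ^ 2 / 4 := fun x => by ring
  rw [sum_congr rfl fun x _ => h3 x, sum_add_distrib, sum_sub_distrib, ← mul_sum, h1]
  simp only [sum_const, card_univ, nsmul_eq_mul]
  change _ - _ + N * _ ≤ _
  nlinarith

/-- A function that is close to low degree on many hyperplanes is close to low degree. -/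
theorem exists_close_of_many_hyperplanes {d : ℕ} (f : V → ZMod 2)
    (B : Finset (Module.Dual (ZMod 2) V × ZMod 2)) (hB0 : ∀ h ∈ B, h.1 ≠ 0)
    (p : Module.Dual (ZMod 2) V × ZMod 2 → V → ZMod 2) (hp : ∀ h ∈ B, DegLT (d + 1) (p h))
    (hclose : ∀ h ∈ B,
      64 * 2 ^ d * (univ.filter fun x => h.1 x = h.2 ∧ f x ≠ p h x).card < Fintype.card V)
    (hB : 64 * 2 ^ d ≤ B.card) :
    ∃ P, DegLT (d + 1) P ∧
      8 * 2 ^ d * ((univ.filter fun x => f x ≠ P x).card : ℝ) ≤ (Fintype.card V : ℝ) := by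
  have hd : 0 < 2 ^ d := by positivity
  obtain ⟨P, hP, hPB⟩ := exists_common_extension f B p hp hclose (by
    rw [pow_add]; omega)
  refine ⟨P, hP, ?_⟩
  set N : ℝ := ((Fintype.card V : ℕ) : ℝ) with hN
  set K : ℝ := ((B.card : ℕ) : ℝ) with hK
  set D : ℝ := 2 ^ d with hD
  have hDpos : 0 < D := by positivity
  have hKD : 64 * D ≤ K := by rw [hD, hK]; exact_mod_cast hB
  have hKpos : 0 < K := by linarith
  set c : V → ℝ := fun x => ∑ h ∈ B, if h.1 x = h.2 then (1 : ℝ) else 0 with hc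
  -- An error on at least `K / 4` hyperplanes of `B` is charged to the errors on those hyperplanes;
  -- any other error is at a point deviating by `K / 4` from the mean `K / 2` and is charged to the
  -- variance. Each kind totals at most `N / (16 * D)`.
  have hpt : ∀ x, (if f x ≠ P x then (1 : ℝ) else 0) ≤
      (if f x ≠ P x then c x else 0) * (4 / K) + (c x - K / 2) ^ 2 * (16 / K ^ 2) := by
    intro x
    have h2 : 0 ≤ (c x - K / 2) ^ 2 * (16 / K ^ 2) := by positivity
    split_ifs with hx
    · by_cases hcx : K / 4 ≤ c x
      · have : 1 ≤ c x * (4 / K) := by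
          rw [mul_div_assoc', le_div_iff₀ hKpos]; linarith
        linarith
      · push Not at hcx
        have h0 : 0 ≤ c x := sum_nonneg fun h _ => by split_ifs <;> norm_num
        have h3 : 0 ≤ c x * (4 / K) := by positivity
        have h4 : 1 ≤ (c x - K / 2) ^ 2 * (16 / K ^ 2) := by
          rw [mul_div_assoc', le_div_iff₀ (by positivity)]
          nlinarith
        linarith
    · simpa using h2
  have hsum := sum_le_sum fun x (_ : x ∈ (univ : Finset V)) => hpt x
  rw [sum_add_distrib, ← sum_mul, ← sum_mul] at hsum
  have hvar : ∑ x : V, (c x - K / 2) ^ 2 ≤ N * K / 4 := card_incidence_sq_le B hB0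
  have hE : ∑ x : V, (if f x ≠ P x then c x else 0) ≤ K * (N / (64 * D)) := by
    have e1 : ∀ x : V, (if f x ≠ P x then c x else 0) =
        ∑ h ∈ B, if h.1 x = h.2 ∧ f x ≠ p h x then (1 : ℝ) else 0 := by
      intro x
      by_cases hx : f x ≠ P x
      · rw [if_pos hx]
        refine sum_congr rfl fun h hh => ?_
        by_cases hhx : h.1 x = h.2
        · rw [if_pos hhx, if_pos ⟨hhx, by rwa [← hPB h hh x hhx]⟩]
        · rw [if_neg hhx, if_neg fun h => hhx h.1]
      · rw [if_neg hx, sum_eq_zero]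
        intro h hh
        rw [if_neg]
        rintro ⟨hhx, h2⟩
        exact hx (by rwa [hPB h hh x hhx])
    rw [sum_congr rfl fun x _ => e1 x, sum_comm]
    calc _ ≤ ∑ h ∈ B, N / (64 * D) := by
          refine sum_le_sum fun h hh => ?_
          have := hclose h hh
          rw [card_filter] at this
          have h' : 64 * D * ∑ x : V, (if h.1 x = h.2 ∧ f x ≠ p h x then (1 : ℝ) else 0) < N := by
            rw [hD, hN]; exact_mod_cast this
          rw [le_div_iff₀ (by positivity)]
          linarith
      _ = _ := by simp [K]
  have hNn : 0 ≤ N := by positivity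
  have e1 : (∑ x : V, (if f x ≠ P x then c x else 0)) * (4 / K) ≤ N / (16 * D) := by
    calc _ ≤ K * (N / (64 * D)) * (4 / K) := by gcongr
      _ = N / (16 * D) := by field_simp; ring
  have e2 : (∑ x : V, (c x - K / 2) ^ 2) * (16 / K ^ 2) ≤ N / (16 * D) := by
    calc _ ≤ N * K / 4 * (16 / K ^ 2) := by gcongr
      _ = N * (4 / K) := by field_simp; ring
      _ ≤ N * (4 / (64 * D)) := by gcongr
      _ = N / (16 * D) := by field_simp; ring
  have e3 : ((univ.filter fun x => f x ≠ P x).card : ℝ) ≤ N / (16 * D) + N / (16 * D) := by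
    rw [card_filter]
    push_cast
    linarith
  calc 8 * D * ((univ.filter fun x => f x ≠ P x).card : ℝ)
      ≤ 8 * D * (N / (16 * D) + N / (16 * D)) := by gcongr
    _ = N := by field_simp; ring

end Interpolation

/-! ### Lower bounds for the rejection probability on parallelepipeds. -/

section Rejection

variable {V : Type} [AddCommGroup V] [Module (ZMod 2) V]

/-- The indicator of `z ≠ 0`. -/
noncomputable def ind (z : ZMod 2) : ℝ := if z = 0 then 0 else 1

theorem ind_nonneg (z : ZMod 2) : 0 ≤ ind z := by
  unfold ind; split_ifs <;> norm_num

theorem ind_mul_self (z : ZMod 2) : ind z * ind z = ind z := by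
  unfold ind; split_ifs <;> norm_num

/-- The number of parallelepipeds on which `f` has a nonzero sum. -/
noncomputable def rejCount [Fintype V] (k : ℕ) (f : V → ZMod 2) : ℝ :=
  ∑ a : V, ∑ v : Fin k → V, ind (cubeSum f a v)

/-- The probability that `f` has a nonzero sum on a random parallelepiped. -/
noncomputable def rej [Fintype V] (k : ℕ) (f : V → ZMod 2) : ℝ :=
  rejCount k f / (Fintype.card V : ℝ) ^ (k + 1)

/-- With `m` nonzero terms the left side is 2m - m², which is 1 at m = 1 and at most 0 otherwise.
Parity is thus bounded by two moments. -/
theorem ind_sum_ge {T : Type} [Fintype T] (g : T → ZMod 2) :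
    2 * (∑ t, ind (g t)) - (∑ t, ind (g t)) ^ 2 ≤ ind (∑ t, g t) := by
  set m := (univ.filter fun t => g t ≠ 0).card with hm
  have h1 : ∑ t, ind (g t) = m := by
    rw [hm, card_filter]
    push_cast
    exact sum_congr rfl fun t _ => by unfold ind; split_ifs <;> simp_all
  have h2 : ∑ t, g t = (m : ZMod 2) := by
    rw [hm, card_filter]
    push_cast
    refine sum_congr rfl fun t _ => ?_
    rcases zmod_two_cases (g t) with h | h <;> simp [h]
  rw [h1, h2]
  by_cases h : m = 1
  · rw [h]; simp [ind]; norm_num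
  · refine le_trans ?_ (ind_nonneg _)
    by_cases h0 : m = 0
    · simp [h0]
    · have : (2 : ℝ) ≤ m := by
        have : 2 ≤ m := by omega
        exact_mod_cast this
      nlinarith

/-- Distinct corners of a random parallelepiped are independent uniform points: their difference is
a nonzero combination of the edges. -/
theorem sum_pair_eq [Fintype V] {k : ℕ} (g : V → ZMod 2) {t s : Fin k → ZMod 2} (hts : t ≠ s) :
    (Fintype.card V : ℝ) * ∑ v : Fin k → V, ∑ a : V,
      ind (g (a + ∑ i, t i • v i)) * ind (g (a + ∑ i, s i • v i)) =
    (Fintype.card V : ℝ) ^ k * (∑ x, ind (g x)) ^ 2 := by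
  have h1 : ∀ v : Fin k → V, ∑ a : V,
      ind (g (a + ∑ i, t i • v i)) * ind (g (a + ∑ i, s i • v i)) =
      ∑ a : V, ind (g a) * ind (g (a + ∑ i, (s i - t i) • v i)) := by
    intro v
    rw [← Equiv.sum_comp (Equiv.subRight (∑ i, t i • v i))]
    refine sum_congr rfl fun a _ => ?_
    simp only [Equiv.subRight_apply, sub_add_cancel, sub_smul, sum_sub_distrib]
    rw [show a - ∑ i, t i • v i + ∑ i, s i • v i = a + (∑ i, s i • v i - ∑ i, t i • v i) by abel]
  rw [sum_congr rfl fun v _ => h1 v, sum_comm, mul_sum]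
  obtain ⟨j, hj⟩ : ∃ j, s j - t j ≠ 0 := by
    by_contra! h
    exact hts (funext fun j => (sub_eq_zero.1 (h j)).symm)
  let φ : (Fin k → V) →+ V :=
    { toFun := fun v => ∑ i, (s i - t i) • v i
      map_zero' := by simp
      map_add' := fun x y => by simp [sum_add_distrib] }
  have hφ : Function.Surjective φ := by
    intro y
    refine ⟨Pi.single j ((s j - t j)⁻¹ • y), ?_⟩
    change ∑ i, (s i - t i) • (Pi.single j ((s j - t j)⁻¹ • y) : Fin k → V) i = y
    rw [sum_eq_single j]
    · rw [Pi.single_eq_same, smul_smul, mul_inv_cancel₀ hj, one_smul]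
    · intro i _ hi; rw [Pi.single_eq_of_ne hi, smul_zero]
    · simp
  have h2 : ∀ a : V, (Fintype.card V : ℝ) * ∑ v : Fin k → V,
      ind (g a) * ind (g (a + ∑ i, (s i - t i) • v i)) =
      ind (g a) * ((Fintype.card V : ℝ) ^ k * ∑ x, ind (g x)) := by
    intro a
    rw [← mul_sum]
    have := card_mul_sum_comp φ hφ (fun y => ind (g (a + y)))
    have h3 : ∑ y, ind (g (a + y)) = ∑ x, ind (g x) :=
      Equiv.sum_comp (Equiv.addLeft a) (fun x => ind (g x))
    rw [h3, Fintype.card_fun, Fintype.card_fin] at this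
    push_cast at this
    rw [← this]
    change _ = ind (g a) * (_ * ∑ v : Fin k → V, ind (g (a + ∑ i, (s i - t i) • v i)))
    ring
  rw [sum_congr rfl fun a _ => h2 a, ← sum_mul]
  ring

/-- Second moment bound: a function at small distance `δ` from low degree is rejected with
probability about `2ᵏ δ`. -/
theorem rej_ge_of_close [Fintype V] {k : ℕ} (f p : V → ZMod 2) (hp : DegLT k p) (μ : ℝ)
    (hμ : μ = 2 ^ k * ((univ.filter fun x => f x ≠ p x).card : ℝ) / (Fintype.card V : ℝ)) :
    μ - μ ^ 2 ≤ rej k f := by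
  set N : ℝ := (Fintype.card V : ℝ) with hN
  have hNpos : 0 < N := by rw [hN]; exact_mod_cast Fintype.card_pos
  set g : V → ZMod 2 := fun x => f x + p x with hg
  set E : ℝ := ∑ x, ind (g x) with hE
  have hEcard : ((univ.filter fun x => f x ≠ p x).card : ℝ) = E := by
    rw [hE, card_filter]
    push_cast
    refine sum_congr rfl fun x _ => ?_
    unfold ind
    simp only [hg, CharTwo.add_eq_zero]
    split_ifs <;> simp_all
  have hpt : ∀ (a : V) (v : Fin k → V),
      2 * (∑ t : Fin k → ZMod 2, ind (g (a + ∑ i, t i • v i))) -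
        (∑ t : Fin k → ZMod 2, ind (g (a + ∑ i, t i • v i))) ^ 2 ≤ ind (cubeSum f a v) := by
    intro a v
    have h1 : cubeSum f a v = cubeSum g a v := by
      rw [hg, cubeSum_add, degLT_iff_cubeSum.1 hp, add_zero]
    rw [h1]
    exact ind_sum_ge _
  have hshift : ∀ y : V, ∑ a, ind (g (a + y)) = E := fun y =>
    Equiv.sum_comp (Equiv.addRight y) (fun x => ind (g x))
  have hfirst : ∑ a : V, ∑ v : Fin k → V, ∑ t : Fin k → ZMod 2, ind (g (a + ∑ i, t i • v i)) =
      2 ^ k * N ^ k * E := by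
    rw [sum_comm]
    rw [sum_congr rfl fun v _ => sum_comm]
    rw [sum_congr rfl fun v _ => sum_congr rfl fun t _ => hshift _]
    simp [hN, ZMod.card]
    ring
  have hsecond : ∑ a : V, ∑ v : Fin k → V,
      (∑ t : Fin k → ZMod 2, ind (g (a + ∑ i, t i • v i))) ^ 2 ≤
      2 ^ k * (N ^ k * E + 2 ^ k * (N ^ k * E ^ 2 / N)) := by
    have e1 : ∑ a : V, ∑ v : Fin k → V,
        (∑ t : Fin k → ZMod 2, ind (g (a + ∑ i, t i • v i))) ^ 2 =
        ∑ t : Fin k → ZMod 2, ∑ s : Fin k → ZMod 2, ∑ v : Fin k → V, ∑ a : V,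
          ind (g (a + ∑ i, t i • v i)) * ind (g (a + ∑ i, s i • v i)) := by
      rw [sum_comm]
      simp only [sq, sum_mul_sum]
      rw [sum_congr rfl fun v _ => sum_comm, sum_comm]
      refine sum_congr rfl fun t _ => ?_
      rw [sum_congr rfl fun v _ => sum_comm, sum_comm]
    have e2 : ∀ t s : Fin k → ZMod 2, ∑ v : Fin k → V, ∑ a : V,
          ind (g (a + ∑ i, t i • v i)) * ind (g (a + ∑ i, s i • v i)) ≤
        (if s = t then N ^ k * E else 0) + N ^ k * E ^ 2 / N := by
      intro t s
      have hpos : 0 ≤ N ^ k * E ^ 2 / N := by positivity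
      by_cases hst : s = t
      · subst hst
        rw [if_pos rfl]
        have : ∑ v : Fin k → V, ∑ a : V,
            ind (g (a + ∑ i, s i • v i)) * ind (g (a + ∑ i, s i • v i)) = N ^ k * E := by
          simp only [ind_mul_self, hshift]
          simp [hN]
        linarith
      · rw [if_neg hst, zero_add, le_div_iff₀ hNpos, mul_comm]
        exact (sum_pair_eq g (Ne.symm hst)).le
    rw [e1]
    refine (sum_le_sum fun t _ => sum_le_sum fun s _ => e2 t s).trans ?_
    simp only [sum_add_distrib, sum_ite_eq', mem_univ, if_true, sum_const, card_univ,
      Fintype.card_fun, Fintype.card_fin, ZMod.card, nsmul_eq_mul]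
    push_cast
    refine le_of_eq ?_
    ring
  -- After normalization the number of errors has mean μ and second moment at most μ + μ², so 2μ -
  -- (μ + μ²) remains.
  have htotal : 2 * (2 ^ k * N ^ k * E) - 2 ^ k * (N ^ k * E + 2 ^ k * (N ^ k * E ^ 2 / N)) ≤
      rejCount k f := by
    have := sum_le_sum fun a (_ : a ∈ (univ : Finset V)) =>
      sum_le_sum fun v (_ : v ∈ (univ : Finset (Fin k → V))) => hpt a v
    simp only [sum_sub_distrib, ← mul_sum] at this
    rw [hfirst] at this
    unfold rejCount
    linarith
  unfold rej
  rw [le_div_iff₀ (by positivity), ← hN]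
  refine le_trans (le_of_eq ?_) htotal
  rw [hμ, hEcard]
  field_simp
  ring

/-- Only ∏ (1 - 2^(-i)) ≥ 1/4 is needed; the extra `1 / (4 * 2 ^ k)` shrinks at each step to pay for
the new factor. -/
theorem prod_two_pow_sub_ge (k : ℕ) :
    ((2 : ℝ) ^ (k + 1)) ^ (k + 1) * (1 / 4 + 1 / (4 * 2 ^ k)) ≤
      ∏ i ∈ range (k + 1), ((2 : ℝ) ^ (k + 1) - 2 ^ i) := by
  induction k with
  | zero => norm_num
  | succ k ih =>
    rw [prod_range_succ']
    have h1 : ∏ i ∈ range (k + 1), ((2 : ℝ) ^ (k + 1 + 1) - 2 ^ (i + 1)) =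
        2 ^ (k + 1) * ∏ i ∈ range (k + 1), ((2 : ℝ) ^ (k + 1) - 2 ^ i) := by
      rw [prod_congr rfl (g := fun i => 2 * ((2 : ℝ) ^ (k + 1) - 2 ^ i))
        (fun i _ => by ring), prod_mul_distrib]
      simp
    rw [h1]
    set y : ℝ := 2 ^ k with hy
    have hy1 : 1 ≤ y := one_le_pow₀ (by norm_num)
    set A : ℝ := ((2 : ℝ) ^ (k + 1)) ^ (k + 1) with hA
    have hApos : 0 < A := by positivity
    have h2 : ((2 : ℝ) ^ (k + 1 + 1)) ^ (k + 1 + 1) = 4 * y * (2 * y * A) := by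
      have e1 : (2 : ℝ) ^ (k + 1 + 1) = 2 * 2 ^ (k + 1) := by ring
      have e2 : (2 : ℝ) * 2 ^ (k + 1) = 4 * y := by rw [hy]; ring
      rw [e1, mul_pow, pow_succ _ (k + 1), pow_succ _ (k + 1), ← hA]
      have e3 : (2 : ℝ) ^ (k + 1) = 2 * y := by rw [hy]; ring
      rw [e3]; ring
    have h3 : (2 : ℝ) ^ (k + 1 + 1) = 4 * y := by rw [hy]; ring
    have h4 : (2 : ℝ) ^ (k + 1) = 2 * y := by rw [hy]; ring
    rw [h4] at ih
    rw [h2, h3, h4, pow_zero]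
    have h5 : 4 * y * (1 / 4 + 1 / (4 * (2 * y))) ≤ (1 / 4 + 1 / (4 * y)) * (4 * y - 1) := by
      have : (1 / 4 + 1 / (4 * y)) * (4 * y - 1) - 4 * y * (1 / 4 + 1 / (4 * (2 * y))) =
        (y - 1) / (4 * y) := by field_simp; ring
      have h6 : 0 ≤ (y - 1) / (4 * y) := div_nonneg (by linarith) (by linarith)
      linarith
    calc 4 * y * (2 * y * A) * (1 / 4 + 1 / (4 * (2 * y)))
        = 2 * y * A * (4 * y * (1 / 4 + 1 / (4 * (2 * y)))) := by ring
      _ ≤ 2 * y * A * ((1 / 4 + 1 / (4 * y)) * (4 * y - 1)) := by gcongr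
      _ = 2 * y * (A * (1 / 4 + 1 / (4 * y))) * (4 * y - 1) := by ring
      _ ≤ _ := by
        refine mul_le_mul_of_nonneg_right ?_ (by linarith)
        exact mul_le_mul_of_nonneg_left ih (by linarith)

theorem card_linearIndependent_ge [Fintype V] {k : ℕ} (hk : Module.finrank (ZMod 2) V = k) :
    (Fintype.card V : ℝ) ^ k / 4 ≤
      (univ.filter fun v : Fin k → V => LinearIndependent (ZMod 2) v).card := by
  have h := card_linearIndependent (K := ZMod 2) (V := V) (k := k) hk.ge
  rw [Nat.card_eq_fintype_card, Fintype.card_subtype, hk, ZMod.card] at h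
  rw [h, card_eq_two_pow (V := V), hk, Fin.prod_univ_eq_prod_range (fun i => 2 ^ k - 2 ^ i)]
  push_cast
  rw [prod_congr rfl (g := fun i => (2 : ℝ) ^ k - 2 ^ i)]
  · cases k with
    | zero => norm_num
    | succ k =>
      refine le_trans ?_ (prod_two_pow_sub_ge k)
      rw [div_eq_mul_one_div]
      refine mul_le_mul_of_nonneg_left ?_ (by positivity)
      have : (0 : ℝ) ≤ 1 / (4 * 2 ^ k) := by positivity
      linarith
  · intro i hi
    rw [Nat.cast_sub (Nat.pow_le_pow_right (by norm_num) (mem_range.1 hi).le)]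
    push_cast
    rfl

theorem rej_ge_of_finrank_eq [Fintype V] {k : ℕ} (hk : Module.finrank (ZMod 2) V = k)
    {f : V → ZMod 2} (hf : ¬ DegLT k f) : 1 / 4 ≤ rej k f := by
  have hsum : ∑ x, f x ≠ 0 := fun h => hf (degLT_finrank_of_sum_eq_zero hk h)
  have hNpos : (0 : ℝ) < Fintype.card V := by exact_mod_cast Fintype.card_pos
  unfold rej
  rw [le_div_iff₀ (by positivity)]
  have h1 : ∀ a : V, (Fintype.card V : ℝ) ^ k / 4 ≤ ∑ v : Fin k → V, ind (cubeSum f a v) := by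
    intro a
    refine (card_linearIndependent_ge hk).trans ?_
    rw [card_filter]
    push_cast
    refine sum_le_sum fun v _ => ?_
    split_ifs with hv
    · rw [cubeSum_eq_sum f a hv hk, ind, if_neg hsum]
    · exact ind_nonneg _
  have h2 := sum_le_sum fun a (_ : a ∈ (univ : Finset V)) => h1 a
  rw [sum_const, card_univ, nsmul_eq_mul] at h2
  refine le_trans (le_of_eq ?_) h2
  ring

theorem card_annihilator [Fintype V] {k : ℕ} {v : Fin k → V} (hv : LinearIndependent (ZMod 2) v) :
    (2 : ℝ) ^ k * (univ.filter fun l : Module.Dual (ZMod 2) V => ∀ i, l (v i) = 0).card =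
      Fintype.card V := by
  have h1 : (univ.filter fun l : Module.Dual (ZMod 2) V => ∀ i, l (v i) = 0).card =
      Fintype.card (Submodule.span (ZMod 2) (Set.range v)).dualAnnihilator := by
    rw [← Fintype.card_subtype]
    refine Fintype.card_congr (Equiv.subtypeEquivRight fun l => ?_)
    rw [Submodule.mem_dualAnnihilator]
    constructor
    · intro h w hw
      have : Submodule.span (ZMod 2) (Set.range v) ≤ LinearMap.ker l := by
        rw [Submodule.span_le]
        rintro _ ⟨i, rfl⟩
        exact h i
      exact this hw
    · exact fun h i => h _ (Submodule.subset_span ⟨i, rfl⟩)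
  have h2 := Subspace.finrank_add_finrank_dualAnnihilator_eq
    (Submodule.span (ZMod 2) (Set.range v))
  rw [finrank_span_eq_card hv, Fintype.card_fin] at h2
  rw [h1, card_eq_two_pow, card_eq_two_pow (V := V), ← h2, pow_add]
  push_cast
  ring

theorem card_ker [Fintype V] {l : Module.Dual (ZMod 2) V} (hl : l ≠ 0) :
    (2 : ℝ) * Fintype.card (LinearMap.ker l) = Fintype.card V := by
  rw [← two_mul_card_hyperplane hl 0, ← Fintype.card_subtype]
  simp only [LinearMap.mem_ker]

theorem sum_rejCount_ker [Fintype V] {k : ℕ} (f : V → ZMod 2) (l : Module.Dual (ZMod 2) V) :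
    ∑ u : V, rejCount k (fun x : LinearMap.ker l => f (u + x)) =
      Fintype.card (LinearMap.ker l) * ∑ a : V, ∑ v : Fin k → V,
        (if ∀ i, l (v i) = 0 then ind (cubeSum f a v) else 0) := by
  have h1 : ∀ u : V, rejCount k (fun x : LinearMap.ker l => f (u + x)) =
      ∑ a : LinearMap.ker l, ∑ v : Fin k → V,
        (if ∀ i, l (v i) = 0 then ind (cubeSum f (u + a) v) else 0) := by
    intro u
    refine sum_congr rfl fun a _ => ?_
    refine Fintype.sum_of_injective (fun (v : Fin k → LinearMap.ker l) i => (v i : V)) ?_ _ _ ?_ ?_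
    · intro v w h
      exact funext fun i => Subtype.ext (congrFun h i)
    · intro v hv
      rw [if_neg]
      intro h
      exact hv ⟨fun i => ⟨v i, h i⟩, rfl⟩
    · intro v
      rw [if_pos fun i => LinearMap.mem_ker.1 (v i).2]
      unfold cubeSum
      simp [add_assoc]
  rw [sum_congr rfl fun u _ => h1 u, sum_comm]
  have h2 : ∀ a : LinearMap.ker l, ∑ u : V, ∑ v : Fin k → V,
        (if ∀ i, l (v i) = 0 then ind (cubeSum f (u + a) v) else 0) =
      ∑ a : V, ∑ v : Fin k → V, (if ∀ i, l (v i) = 0 then ind (cubeSum f a v) else 0) := fun a =>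
    Equiv.sum_comp (Equiv.addRight (a : V)) (fun u => ∑ v : Fin k → V,
      (if ∀ i, l (v i) = 0 then ind (cubeSum f u v) else 0))
  rw [sum_congr rfl fun a _ => h2 a]
  simp

theorem rejCount_nonneg [Fintype V] (k : ℕ) (f : V → ZMod 2) : 0 ≤ rejCount k f :=
  sum_nonneg fun _ _ => sum_nonneg fun _ _ => ind_nonneg _

/-- Averaging over the affine hyperplanes `u + ker l`. -/
theorem rej_ge_of_hyperplanes [Fintype V] {k : ℕ} (f : V → ZMod 2) {ε : ℝ}
    (G : Finset (Module.Dual (ZMod 2) V × V)) (hG0 : ∀ g ∈ G, g.1 ≠ 0)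
    (hG : ∀ g ∈ G, ε ≤ rej k (fun x : LinearMap.ker g.1 => f (g.2 + x))) :
    ε * G.card / (Fintype.card V : ℝ) ^ 2 ≤ rej k f := by
  set N : ℝ := (Fintype.card V : ℝ) with hN
  have hNpos : 0 < N := by rw [hN]; exact_mod_cast Fintype.card_pos
  have h1 : ∀ g ∈ G, ε * (N / 2) ^ (k + 1) ≤
      rejCount k (fun x : LinearMap.ker g.1 => f (g.2 + x)) := by
    intro g hg
    have hc := card_ker (hG0 g hg)
    rw [← hN] at hc
    have h := hG g hg
    unfold rej at h
    rw [show (Fintype.card (LinearMap.ker g.1) : ℝ) = N / 2 by linarith,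
      le_div_iff₀ (by positivity)] at h
    exact h
  have h2 : ∀ l : Module.Dual (ZMod 2) V, l ≠ 0 →
      ∑ u : V, rejCount k (fun x : LinearMap.ker l => f (u + x)) =
      N / 2 * ∑ a : V, ∑ v : Fin k → V,
        (if ∀ i, l (v i) = 0 then ind (cubeSum f a v) else 0) := by
    intro l hl
    have hc := card_ker hl
    rw [← hN] at hc
    rw [sum_rejCount_ker, show (Fintype.card (LinearMap.ker l) : ℝ) = N / 2 by linarith]
  have h3 : ∑ g ∈ G, rejCount k (fun x : LinearMap.ker g.1 => f (g.2 + x)) ≤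
      ∑ l ∈ univ.filter (fun l : Module.Dual (ZMod 2) V => l ≠ 0),
        ∑ u : V, rejCount k (fun x : LinearMap.ker l => f (u + x)) := by
    rw [← sum_product']
    refine sum_le_sum_of_subset_of_nonneg ?_ fun _ _ _ => rejCount_nonneg _ _
    intro g hg
    simp [hG0 g hg]
  have h4 : ∑ l ∈ univ.filter (fun l : Module.Dual (ZMod 2) V => l ≠ 0),
        ∑ u : V, rejCount k (fun x : LinearMap.ker l => f (u + x)) ≤
      N / 2 * ∑ a : V, ∑ v : Fin k → V, N / 2 ^ k * ind (cubeSum f a v) := by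
    rw [sum_congr rfl fun l hl => h2 l (mem_filter.1 hl).2, ← mul_sum]
    refine mul_le_mul_of_nonneg_left ?_ (by positivity)
    refine (sum_le_univ_sum_of_nonneg fun l => sum_nonneg fun a _ => sum_nonneg fun v _ => ?_).trans
      ?_
    · split_ifs
      · exact ind_nonneg _
      · exact le_rfl
    rw [sum_comm]
    refine sum_le_sum fun a _ => ?_
    rw [sum_comm]
    refine sum_le_sum fun v _ => ?_
    -- All independent `v` are annihilated by the same number `N / 2 ^ k` of functionals, so
    -- hyperplane averaging weights them equally; dependent `v` contribute zero.
    by_cases hv : LinearIndependent (ZMod 2) v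
    · have := card_annihilator hv
      rw [card_filter] at this
      push_cast at this
      have e : ∑ l : Module.Dual (ZMod 2) V,
          (if ∀ i, l (v i) = 0 then ind (cubeSum f a v) else 0) =
          (∑ l : Module.Dual (ZMod 2) V, if ∀ i, l (v i) = 0 then (1 : ℝ) else 0) *
            ind (cubeSum f a v) := by
        rw [sum_mul]
        exact sum_congr rfl fun l _ => by split_ifs <;> simp
      rw [e, hN, ← this]
      refine le_of_eq ?_
      field_simp
    · rw [cubeSum_eq_zero_of_not_linearIndependent f a hv]
      simp [ind]
  have h5 := sum_le_sum h1
  rw [sum_const, nsmul_eq_mul] at h5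
  have h6 := (h5.trans h3).trans h4
  simp only [← mul_sum] at h6
  change _ ≤ N / 2 * (N / 2 ^ k * rejCount k f) at h6
  unfold rej
  rw [div_le_div_iff₀ (by positivity) (by positivity), ← hN]
  have h7 : (G.card : ℝ) * (ε * (N / 2) ^ (k + 1)) = ε * G.card * N ^ (k + 1) / 2 ^ (k + 1) := by
    rw [div_pow]; ring
  have h8 : N / 2 * (N / 2 ^ k * rejCount k f) = rejCount k f * N ^ 2 / 2 ^ (k + 1) := by
    rw [pow_succ (2 : ℝ)]; field_simp
  rw [h7, h8] at h6
  exact (div_le_div_iff_of_pos_right (by positivity)).1 h6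

/-- The extension is constant along a direction `w` transversal to the hyperplane. -/
theorem exists_extension {k : ℕ} {l : Module.Dual (ZMod 2) V} (hl : l ≠ 0) (u : V)
    {p : LinearMap.ker l → ZMod 2} (hp : DegLT k p) :
    ∃ h : V → ZMod 2, DegLT k h ∧ ∀ x : LinearMap.ker l, h (u + x) = p x := by
  obtain ⟨w, hw⟩ := exists_apply_eq_one hl
  have hmem : ∀ x, x + l x • w ∈ LinearMap.ker l := by
    intro x
    simp [hw, CharTwo.add_self_eq_zero]
  refine ⟨fun x => p ⟨(x - u) + l (x - u) • w, hmem _⟩,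
    hp.comp (φ := fun x => ⟨(x - u) + l (x - u) • w, hmem _⟩) (L := fun v => ⟨v + l v • w, hmem v⟩)
      ?_, ?_⟩
  · intro x v
    refine Subtype.ext ?_
    simp only [Submodule.coe_add, add_sub_right_comm, map_add, add_smul]
    abel
  · intro x
    refine congrArg p (Subtype.ext ?_)
    have hx : l (x : V) = 0 := x.2
    simp [hx]

theorem exists_eq_on_hyperplane {k : ℕ} {l : Module.Dual (ZMod 2) V} (hl : l ≠ 0) (u : V)
    {f : V → ZMod 2} (hf : DegLT k (fun x : LinearMap.ker l => f (u + x))) :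
    ∃ h : V → ZMod 2, DegLT k h ∧ ∀ x, l x = l u → h x = f x := by
  obtain ⟨h, h1, h2⟩ := exists_extension hl u hf
  refine ⟨h, h1, fun x hx => ?_⟩
  have := h2 ⟨x - u, by simp [hx]⟩
  simpa using this

/-- The factor is the indicator of `u + ker l`, so `f` may be replaced by a low-degree extension of
its restriction, and an affine factor costs one degree. -/
theorem DegLT.affine_mul_of_hyperplane {k : ℕ} {l : Module.Dual (ZMod 2) V} (hl : l ≠ 0) (u : V)
    {f : V → ZMod 2} (hf : DegLT k (fun x : LinearMap.ker l => f (u + x))) :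
    DegLT (k + 1) (fun x => (l x + (l u + 1)) * f x) := by
  obtain ⟨h, h1, h2⟩ := exists_eq_on_hyperplane hl u hf
  convert h1.affine_mul l (l u + 1) using 2 with x
  by_cases hx : l x = l u
  · rw [h2 x hx]
  · have : l x + (l u + 1) = 0 := by
      revert hx
      generalize l x = y
      generalize l u = z
      revert y z
      decide
    rw [this, zero_mul, zero_mul]

theorem two_mul_card_addSubgroup_le {A : Type} [AddCommGroup A] [Fintype A] (L : AddSubgroup A)
    (hL : L ≠ ⊤) : 2 * (univ.filter fun x => x ∈ L).card ≤ Fintype.card A := by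
  have h1 := L.card_mul_index
  have h2 : L.index ≠ 1 := fun h => hL (AddSubgroup.index_eq_one.1 h)
  have h3 : L.index ≠ 0 := AddSubgroup.index_ne_zero_of_finite
  rw [← Fintype.card_subtype, ← Nat.card_eq_fintype_card, ← Nat.card_eq_fintype_card, ← h1,
    mul_comm]
  exact Nat.mul_le_mul_left _ (by omega)

theorem card_dual [Fintype V] : Fintype.card (Module.Dual (ZMod 2) V) = Fintype.card V := by
  rw [card_eq_two_pow, card_eq_two_pow, Subspace.dual_finrank_eq]

/-- Multiplication by some linear functional raises a degree below the dimension. -/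
theorem exists_mul_not_degLT [Fintype V] {D : ℕ} (hD : D < Module.finrank (ZMod 2) V)
    {f : V → ZMod 2} (hf : DegLT (D + 1) f) (hf' : ¬ DegLT D f) :
    ∃ l : Module.Dual (ZMod 2) V, ¬ DegLT (D + 1) (fun x => l x * f x) := by
  rw [degLT_iff_cubeSum] at hf'
  push Not at hf'
  obtain ⟨a, v, hav⟩ := hf'
  have hlt : Submodule.span (ZMod 2) (Set.range v) < ⊤ := by
    refine lt_top_iff_ne_top.2 fun h => ?_
    have h1 := finrank_range_le_card (R := ZMod 2) v
    rw [Set.finrank, h, finrank_top, Fintype.card_fin] at h1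
    omega
  obtain ⟨l, hl, hker⟩ := Submodule.exists_le_ker_of_lt_top _ hlt
  obtain ⟨w, hw⟩ := exists_apply_eq_one hl
  have hlv : ∀ i, l (v i) = 0 := fun i => hker (Submodule.subset_span ⟨i, rfl⟩)
  have hmul : ∀ a, cubeSum (fun x => l x * f x) a v = l a * cubeSum f a v := by
    intro a
    unfold cubeSum
    rw [mul_sum]
    refine sum_congr rfl fun t _ => ?_
    simp [hlv]
  -- Since `f` has degree at most `D`, its sums over the boxes at `a` and `a + w` agree. In the box
  -- enlarged by `w` they get the weights `l a` and `l a + 1`, so `l * f` has the same nonzero sum.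
  refine ⟨l, fun hdeg => ?_⟩
  have h1 := degLT_iff_cubeSum.1 hdeg a (Fin.cons w v)
  have h2 := degLT_iff_cubeSum.1 hf a (Fin.cons w v)
  have hshift : ∀ g : V → ZMod 2, cubeSum (fun x => g (x + w)) a v = cubeSum g (a + w) v := by
    intro g
    unfold cubeSum
    refine sum_congr rfl fun t _ => ?_
    rw [add_right_comm]
  rw [cubeSum_cons, cubeSum_add, hshift] at h2
  rw [cubeSum_cons, cubeSum_add, hshift (fun x => l x * f x), hmul, hmul,
    CharTwo.add_eq_zero.1 h2, ← add_mul, map_add, hw, add_comm (l a), add_assoc,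
    CharTwo.add_self_eq_zero, add_zero, one_mul] at h1
  exact hav h1

/-- If `f` were of degree below `k` on both parallel hyperplanes, it would be a sum of two
truncations of degree at most `k`, and its total sum would vanish. -/
theorem card_good_of_sum_ne_zero [Fintype V] {k : ℕ} (hk : k < Module.finrank (ZMod 2) V)
    {f : V → ZMod 2} (hf : ∑ x, f x ≠ 0) {l : Module.Dual (ZMod 2) V} (hl : l ≠ 0) :
    Fintype.card V ≤
      2 * (univ.filter fun u => ¬ DegLT k (fun x : LinearMap.ker l => f (u + x))).card := by
  obtain ⟨w, hw⟩ := exists_apply_eq_one hl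
  have h1 : (univ.filter fun u => ¬ ¬ DegLT k (fun x : LinearMap.ker l => f (u + x))).card ≤
      (univ.filter fun u => ¬ DegLT k (fun x : LinearMap.ker l => f (u + x))).card := by
    refine card_le_card_of_injOn (fun u => u + w) ?_ (fun x _ y _ h => add_right_cancel h)
    intro u hu
    rw [mem_coe, mem_filter] at hu ⊢
    replace hu := not_not.1 hu.2
    refine ⟨mem_univ _, ?_⟩
    intro hu'
    have h2 := hu.affine_mul_of_hyperplane hl u
    have h3 := hu'.affine_mul_of_hyperplane hl (u + w)
    refine hf (DegLT.sum_eq_zero hk ?_)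
    convert h2.add h3 using 2 with x
    rw [map_add, hw, ← add_mul]
    have : l x + (l u + 1) + (l x + (l u + 1 + 1)) = 1 := by
      generalize l x = y
      generalize l u = z
      revert y z
      decide
    rw [this, one_mul]
  have h2 := card_filter_add_card_filter_not (s := (univ : Finset V))
    (fun u => ¬ DegLT k (fun x : LinearMap.ker l => f (u + x)))
  rw [card_univ] at h2
  omega

/-- A function of large degree has large degree on a quarter of the hyperplanes. -/
theorem card_hyperplanes_not_degLT [Fintype V] {k : ℕ} (hk : k < Module.finrank (ZMod 2) V)
    {f : V → ZMod 2} (hf : ¬ DegLT k f) :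
    (Fintype.card V : ℝ) ^ 2 / 4 ≤
      (univ.filter fun g : Module.Dual (ZMod 2) V × V =>
        g.1 ≠ 0 ∧ ¬ DegLT k (fun x : LinearMap.ker g.1 => f (g.2 + x))).card := by
  set N := Fintype.card V with hN
  have hN2 : 2 ≤ N := by
    rw [hN, card_eq_two_pow]
    calc 2 = 2 ^ 1 := rfl
      _ ≤ _ := Nat.pow_le_pow_right (by norm_num) (by omega)
  by_cases hs : ∑ x, f x = 0
  · have hex : ∃ m, DegLT m f := ⟨_, degLT_finrank_of_sum_eq_zero rfl hs⟩
    have hm := Nat.find_spec hex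
    have hle : Nat.find hex ≤ Module.finrank (ZMod 2) V :=
      Nat.find_min' hex (degLT_finrank_of_sum_eq_zero rfl hs)
    have hlt : k < Nat.find hex := by
      by_contra! h
      exact hf (hm.mono h)
    obtain ⟨D, hD⟩ : ∃ D, Nat.find hex = D + 1 := ⟨Nat.find hex - 1, by omega⟩
    have hD' : ¬ DegLT D f := Nat.find_min hex (by omega)
    rw [hD] at hm hle hlt
    -- `L` is the proper subgroup of functionals that do not raise the exact degree `D`. If `f` had
    -- degree below `k` on `u + ker l`, then l f = (l + l u + 1) f + (l u + 1) f would put `l` in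
    -- `L`. So every `l` outside `L` works with every `u`.
    let L : AddSubgroup (Module.Dual (ZMod 2) V) :=
      { carrier := {l | DegLT (D + 1) (fun x => l x * f x)}
        zero_mem' := by
          simpa using DegLT.zero (V := V) (D + 1)
        add_mem' := fun {a b} ha hb => by
          change DegLT (D + 1) (fun x => (a + b) x * f x)
          simpa only [LinearMap.add_apply, add_mul] using
            DegLT.add (f := fun x => a x * f x) (g := fun x => b x * f x) ha hb
        neg_mem' := fun {a} ha => by
          change DegLT (D + 1) (fun x => (-a) x * f x)
          have ha' : DegLT (D + 1) (fun x => a x * f x) := ha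
          simpa only [LinearMap.neg_apply, CharTwo.neg_eq] using ha' }
    have hL : L ≠ ⊤ := by
      obtain ⟨l, hl⟩ := exists_mul_not_degLT (by omega) hm hD'
      intro h
      have : l ∈ L := h ▸ AddSubgroup.mem_top l
      exact hl this
    have hcard := two_mul_card_addSubgroup_le L hL
    rw [card_dual, ← hN] at hcard
    have hsplit := card_filter_add_card_filter_not (s := (univ : Finset (Module.Dual (ZMod 2) V)))
      (fun l => l ∈ L)
    rw [card_univ, card_dual, ← hN] at hsplit
    have hsub : (univ.filter fun l => ¬ l ∈ L) ×ˢ (univ : Finset V) ⊆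
        univ.filter fun g : Module.Dual (ZMod 2) V × V =>
          g.1 ≠ 0 ∧ ¬ DegLT k (fun x : LinearMap.ker g.1 => f (g.2 + x)) := by
      rintro ⟨l, u⟩ hlu
      simp only [mem_product, mem_filter, mem_univ, true_and, and_true] at hlu ⊢
      have hl0 : l ≠ 0 := fun h => hlu (h ▸ L.zero_mem)
      refine ⟨hl0, fun hdeg => hlu ?_⟩
      have h1 := (hdeg.affine_mul_of_hyperplane hl0 u).mono (show k + 1 ≤ D + 1 by omega)
      have h2 : DegLT (D + 1) (fun x => (l u + 1) * f x) := by
        rcases zmod_two_cases (l u + 1) with h | h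
        · simpa [h] using DegLT.zero (V := V) (D + 1)
        · simpa [h] using hm
      change DegLT (D + 1) (fun x => l x * f x)
      convert h1.add h2 using 2 with x
      rw [← add_mul, add_assoc, CharTwo.add_self_eq_zero, add_zero]
    have h3 := card_le_card hsub
    rw [card_product, card_univ, ← hN] at h3
    have h4 : N * N ≤ 2 * ((univ.filter fun l => ¬ l ∈ L).card * N) := by
      rw [← mul_assoc]
      exact Nat.mul_le_mul_right _ (by omega)
    have h5 : N * N ≤ 2 * (univ.filter fun g : Module.Dual (ZMod 2) V × V =>
        g.1 ≠ 0 ∧ ¬ DegLT k (fun x : LinearMap.ker g.1 => f (g.2 + x))).card := by omega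
    have h6 : (N : ℝ) * N ≤ 2 * ((univ.filter fun g : Module.Dual (ZMod 2) V × V =>
        g.1 ≠ 0 ∧ ¬ DegLT k (fun x : LinearMap.ker g.1 => f (g.2 + x))).card : ℝ) := by
      exact_mod_cast h5
    nlinarith
  · have h1 : (univ.filter fun g : Module.Dual (ZMod 2) V × V =>
        g.1 ≠ 0 ∧ ¬ DegLT k (fun x : LinearMap.ker g.1 => f (g.2 + x))).card =
        ∑ l ∈ univ.filter (fun l : Module.Dual (ZMod 2) V => l ≠ 0),
        (univ.filter fun u => ¬ DegLT k (fun x : LinearMap.ker l => f (u + x))).card := by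
      rw [card_filter, Fintype.sum_prod_type, sum_filter]
      refine sum_congr rfl fun l _ => ?_
      by_cases hl : l = 0
      · simp [hl]
      · rw [if_pos hl, card_filter]
        simp [hl]
    have h2 : (N - 1) * N ≤ 2 * ∑ l ∈ univ.filter (fun l : Module.Dual (ZMod 2) V => l ≠ 0),
        (univ.filter fun u => ¬ DegLT k (fun x : LinearMap.ker l => f (u + x))).card := by
      rw [mul_sum]
      have hc : (univ.filter (fun l : Module.Dual (ZMod 2) V => l ≠ 0)).card = N - 1 := by
        rw [filter_ne', card_erase_of_mem (mem_univ _), card_univ, card_dual]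
      rw [← hc, ← smul_eq_mul, ← sum_const]
      exact sum_le_sum fun l hl => card_good_of_sum_ne_zero hk hs (mem_filter.1 hl).2
    rw [h1]
    have h3 : (((N - 1 : ℕ) : ℝ)) * N ≤ 2 *
        ((∑ l ∈ univ.filter (fun l : Module.Dual (ZMod 2) V => l ≠ 0),
        (univ.filter fun u => ¬ DegLT k (fun x : LinearMap.ker l => f (u + x))).card : ℕ) : ℝ) := by
      exact_mod_cast h2
    rw [Nat.cast_sub (by omega)] at h3
    have h4 : (2 : ℝ) ≤ N := by exact_mod_cast hN2
    push_cast at h3 ⊢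
    nlinarith

/-- A function that is not of low degree is rejected with probability exponentially small only in
the codimension. -/
theorem rej_ge_of_not_degLT (k j : ℕ) : ∀ (V : Type) [AddCommGroup V] [Module (ZMod 2) V]
    [Fintype V], Module.finrank (ZMod 2) V = k + j → ∀ f : V → ZMod 2, ¬ DegLT k f →
    (1 / 4) ^ (j + 1) ≤ rej k f := by
  induction j with
  | zero =>
    intro V _ _ _ hV f hf
    simpa using rej_ge_of_finrank_eq hV hf
  | succ j ih =>
    intro V _ _ _ hV f hf
    have hNpos : (0 : ℝ) < Fintype.card V := by exact_mod_cast Fintype.card_pos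
    have h1 := card_hyperplanes_not_degLT (by omega) hf
    have h2 := rej_ge_of_hyperplanes f (ε := (1 / 4) ^ (j + 1))
      (univ.filter fun g : Module.Dual (ZMod 2) V × V =>
        g.1 ≠ 0 ∧ ¬ DegLT k (fun x : LinearMap.ker g.1 => f (g.2 + x)))
      (fun g hg => (mem_filter.1 hg).2.1) (fun g hg => by
        refine ih (LinearMap.ker g.1) ?_ _ (mem_filter.1 hg).2.2
        have := Module.Dual.finrank_ker_add_one_of_ne_zero (mem_filter.1 hg).2.1
        omega)
    refine le_trans ?_ h2
    rw [le_div_iff₀ (by positivity), pow_succ (1 / 4 : ℝ) (j + 1), mul_assoc]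
    refine mul_le_mul_of_nonneg_left ?_ (by positivity)
    linarith

end Rejection

/-! ### Functions far from the code: induction on the dimension. -/

section Soundness

/-- `f` is at relative distance at least `2⁻ᵈ / 32` from degree `d`. -/
def Far {V : Type} [AddCommGroup V] [Fintype V] (d : ℕ) (f : V → ZMod 2) : Prop :=
  ∀ p, DegLT (d + 1) p → Fintype.card V ≤ 32 * 2 ^ d * (univ.filter fun x => f x ≠ p x).card

variable {V : Type} [AddCommGroup V] [Module (ZMod 2) V] [Fintype V]

theorem Far.not_degLT {d : ℕ} {f : V → ZMod 2} (hf : Far d f) : ¬ DegLT (d + 1) f := by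
  intro h
  have h1 := hf f h
  simp at h1

/-- The constant 64 becomes 32 because a hyperplane has half of the points. -/
theorem Far.restrict {d : ℕ} {f : V → ZMod 2} {l : Module.Dual (ZMod 2) V} (hl : l ≠ 0) (u : V)
    (hfar : ∀ p, DegLT (d + 1) p → Fintype.card V ≤
      64 * 2 ^ d * (univ.filter fun x => l x = l u ∧ f x ≠ p x).card) :
    Far d (fun x : LinearMap.ker l => f (u + x)) := by
  intro p hp
  obtain ⟨h, h1, h2⟩ := exists_extension hl u hp
  have h3 := hfar h h1
  have h4 : (univ.filter fun x => l x = l u ∧ f x ≠ h x).card ≤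
      (univ.filter fun x : LinearMap.ker l => f (u + x) ≠ p x).card := by
    rw [← card_image_of_injective (univ.filter fun x : LinearMap.ker l => f (u + x) ≠ p x)
      (show Function.Injective (fun x : LinearMap.ker l => u + (x : V)) from
        fun x y h => Subtype.ext (add_left_cancel h))]
    refine card_le_card fun y hy => ?_
    rw [mem_filter] at hy
    obtain ⟨-, hy1, hy2⟩ := hy
    have hmem : y - u ∈ LinearMap.ker l := by simp [hy1]
    refine mem_image.2 ⟨⟨y - u, hmem⟩, mem_filter.2 ⟨mem_univ _, ?_⟩, by simp⟩
    rw [← h2]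
    simpa using hy2
  have h5 : 2 * Fintype.card (LinearMap.ker l) = Fintype.card V := by exact_mod_cast card_ker hl
  have h6 := Nat.mul_le_mul_left (2 ^ d) h4
  change _ ≤ 32 * 2 ^ d * (univ.filter fun x : LinearMap.ker l => f (u + x) ≠ p x).card
  rw [mul_assoc] at h3 ⊢
  omega

/-- The two distance bounds place μ in [1/16, 1/4], where μ - μ² exceeds 1/32. -/
theorem rej_ge_of_far_of_close {d : ℕ} {f P : V → ZMod 2} (hf : Far d f) (hP : DegLT (d + 1) P)
    (hclose : 8 * 2 ^ d * ((univ.filter fun x => f x ≠ P x).card : ℝ) ≤ (Fintype.card V : ℝ)) :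
    1 / 32 ≤ rej (d + 1) f := by
  have hNpos : (0 : ℝ) < Fintype.card V := by exact_mod_cast Fintype.card_pos
  refine le_trans ?_ (rej_ge_of_close f P hP _ rfl)
  set μ : ℝ := 2 ^ (d + 1) * ((univ.filter fun x => f x ≠ P x).card : ℝ) / (Fintype.card V : ℝ)
    with hμ
  have h1 : (Fintype.card V : ℝ) ≤ 32 * 2 ^ d * ((univ.filter fun x => f x ≠ P x).card : ℝ) := by
    exact_mod_cast hf P hP
  have h2 : 1 / 16 ≤ μ := by
    rw [hμ, le_div_iff₀ hNpos, pow_succ]; linarith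
  have h3 : μ ≤ 1 / 4 := by
    rw [hμ, div_le_iff₀ hNpos, pow_succ]; linarith
  nlinarith

theorem card_good_hyperplanes (B : Finset (Module.Dual (ZMod 2) V × ZMod 2))
    (hB0 : ∀ h ∈ B, h.1 ≠ 0) :
    (Fintype.card V : ℝ) ^ 2 - Fintype.card V - B.card * (Fintype.card V / 2) ≤
      (univ.filter fun g : Module.Dual (ZMod 2) V × V => g.1 ≠ 0 ∧ (g.1, g.1 g.2) ∉ B).card := by
  set N : ℝ := (Fintype.card V : ℝ) with hN
  have h1 : ∑ h ∈ B, ((univ.filter fun x : V => h.1 x = h.2).card : ℝ) = B.card * (N / 2) := by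
    rw [← nsmul_eq_mul, ← sum_const]
    refine sum_congr rfl fun h hh => ?_
    have := two_mul_card_hyperplane (hB0 h hh) h.2
    linarith
  have h2 : (univ : Finset (Module.Dual (ZMod 2) V × V)) ⊆
      ((univ.filter fun g : Module.Dual (ZMod 2) V × V => g.1 ≠ 0 ∧ (g.1, g.1 g.2) ∉ B) ∪
        ({0} ×ˢ univ)) ∪
      B.biUnion fun h => {h.1} ×ˢ (univ.filter fun x : V => h.1 x = h.2) := by
    rintro ⟨l, u⟩ -
    simp only [mem_union, mem_filter, mem_univ, true_and, mem_product, mem_singleton, and_true,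
      mem_biUnion]
    by_cases hl : l = 0
    · exact Or.inl (Or.inr hl)
    · by_cases hB : (l, l u) ∈ B
      · exact Or.inr ⟨(l, l u), hB, rfl, rfl⟩
      · exact Or.inl (Or.inl ⟨hl, hB⟩)
  have h3 := (card_le_card h2).trans ((card_union_le _ _).trans
    (Nat.add_le_add (card_union_le _ _) card_biUnion_le))
  simp only [card_univ, Fintype.card_prod, card_dual, card_product, card_singleton, one_mul] at h3
  have h4 : N * N ≤ ((univ.filter fun g : Module.Dual (ZMod 2) V × V =>
      g.1 ≠ 0 ∧ (g.1, g.1 g.2) ∉ B).card : ℝ) + N +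
      ∑ h ∈ B, ((univ.filter fun x : V => h.1 x = h.2).card : ℝ) := by
    rw [hN]; exact_mod_cast h3
  rw [h1] at h4
  linarith

/-- Functions far from degree `d` are rejected with constant probability. -/
theorem rej_ge_of_far_of_finrank (d j : ℕ) : ∀ (V : Type) [AddCommGroup V] [Module (ZMod 2) V]
    [Fintype V], Module.finrank (ZMod 2) V = d + 8 + j → ∀ f : V → ZMod 2, Far d f →
    (1 / 4) ^ 9 * (1 + 1 / 4 / 2 ^ j) ≤ rej (d + 1) f := by
  induction j with
  | zero =>
    intro V _ _ _ hV f hf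
    -- Codimension 7 gives 4^(-8), which leaves room for the surplus factor 1 + 1/4.
    refine le_trans ?_ (rej_ge_of_not_degLT (d + 1) 7 V (by omega) f hf.not_degLT)
    norm_num
  | succ j ih =>
    intro V _ _ _ hV f hf
    set B : Finset (Module.Dual (ZMod 2) V × ZMod 2) := univ.filter fun h => h.1 ≠ 0 ∧
      ∃ p, DegLT (d + 1) p ∧
        64 * 2 ^ d * (univ.filter fun x => h.1 x = h.2 ∧ f x ≠ p x).card < Fintype.card V with hB
    have hB0 : ∀ h ∈ B, h.1 ≠ 0 := fun h hh => (mem_filter.1 hh).2.1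
    set y : ℝ := 1 / 2 ^ j with hy
    have hy0 : 0 < y := by positivity
    have hy1 : y ≤ 1 := by
      rw [hy, div_le_one (by positivity)]; exact one_le_pow₀ (by norm_num)
    have e1 : (1 : ℝ) / 4 / 2 ^ j = y / 4 := by rw [hy]; ring
    have e2 : (1 : ℝ) / 4 / 2 ^ (j + 1) = y / 8 := by rw [hy, pow_succ]; field_simp; norm_num
    rw [e2]
    by_cases hcard : 64 * 2 ^ d ≤ B.card
    · choose! p hp hpc using fun h (hh : h ∈ B) => (mem_filter.1 hh).2.2
      obtain ⟨P, hP, hPc⟩ := exists_close_of_many_hyperplanes f B hB0 p hp hpc hcard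
      refine le_trans ?_ (rej_ge_of_far_of_close hf hP hPc)
      norm_num
      linarith
    · have h1 := card_good_hyperplanes B hB0
      have h2 := rej_ge_of_hyperplanes f (ε := (1 / 4) ^ 9 * (1 + 1 / 4 / 2 ^ j))
        (univ.filter fun g : Module.Dual (ZMod 2) V × V => g.1 ≠ 0 ∧ (g.1, g.1 g.2) ∉ B)
        (fun g hg => (mem_filter.1 hg).2.1) (fun g hg => by
          obtain ⟨hg0, hgB⟩ := (mem_filter.1 hg).2
          refine ih (LinearMap.ker g.1) ?_ _ (Far.restrict hg0 g.2 ?_)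
          · have := Module.Dual.finrank_ker_add_one_of_ne_zero hg0
            omega
          · intro p hp
            by_contra! hlt
            exact hgB (mem_filter.2 ⟨mem_univ _, hg0, p, hp, hlt⟩))
      refine le_trans ?_ h2
      set N : ℝ := (Fintype.card V : ℝ) with hN
      have hNval : N = 2 ^ d * (512 / y) := by
        rw [hN, card_eq_two_pow, hV, hy]
        push_cast
        rw [pow_add, pow_add, pow_succ (2 : ℝ) j]
        field_simp
        norm_num
      have hD : (1 : ℝ) ≤ 2 ^ d := one_le_pow₀ (by norm_num)
      have hNpos : 0 < N := by rw [hNval]; positivity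
      have hK : (B.card : ℝ) ≤ N * (y / 8) := by
        have : B.card ≤ 64 * 2 ^ d := by omega
        have h : (B.card : ℝ) ≤ 64 * 2 ^ d := by exact_mod_cast this
        rw [hNval]
        have e : (2 : ℝ) ^ d * (512 / y) * (y / 8) = 64 * 2 ^ d := by field_simp; norm_num
        rwa [e]
      have hone : 1 ≤ N * (y / 64) := by
        rw [hNval]
        have e : (2 : ℝ) ^ d * (512 / y) * (y / 64) = 8 * 2 ^ d := by field_simp; norm_num
        rw [e]; linarith
      rw [e1, le_div_iff₀ (by positivity), mul_assoc, mul_assoc]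
      refine mul_le_mul_of_nonneg_left ?_ (by positivity)
      refine le_trans ?_ (mul_le_mul_of_nonneg_left h1 (by positivity))
      have h3 : N ^ 2 * (1 - y / 64 - y / 16) ≤ N ^ 2 - N - B.card * (N / 2) := by
        nlinarith [mul_le_mul_of_nonneg_left hK hNpos.le, mul_le_mul_of_nonneg_left hone hNpos.le]
      refine le_trans ?_ (mul_le_mul_of_nonneg_left h3 (by positivity))
      -- The surplus drops from `y / 4` to `y / 8`, which pays for `l = 0` (`y / 64`) and for the
      -- hyperplanes in `B` (`y / 16`).
      have h4 : 1 + y / 8 ≤ (1 + y / 4) * (1 - y / 64 - y / 16) := by nlinarith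
      nlinarith [mul_le_mul_of_nonneg_left h4 (sq_nonneg N)]

theorem rej_ge_of_far {d : ℕ} (hd : d + 1 ≤ Module.finrank (ZMod 2) V) {f : V → ZMod 2}
    (hf : Far d f) : (1 / 4) ^ 9 ≤ rej (d + 1) f := by
  by_cases h : Module.finrank (ZMod 2) V < d + 8
  · obtain ⟨j, hj⟩ := Nat.exists_eq_add_of_le hd
    refine le_trans ?_ (rej_ge_of_not_degLT (d + 1) j V hj f hf.not_degLT)
    exact pow_le_pow_of_le_one (by norm_num) (by norm_num) (by omega)
  · obtain ⟨j, hj⟩ := Nat.exists_eq_add_of_le (not_lt.1 h)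
    refine le_trans ?_ (rej_ge_of_far_of_finrank d j V hj f hf)
    have : (0 : ℝ) ≤ 1 / 4 / 2 ^ j := by positivity
    nlinarith

end Soundness

/-! ### Polynomials versus derivatives; distances in the code. -/

section Polynomials

variable {n : ℕ}

theorem DegLT.sum {V : Type} [AddCommGroup V] [Module (ZMod 2) V] {ι : Type} {k : ℕ} (S : Finset ι)
    {f : ι → V → ZMod 2} (hf : ∀ i ∈ S, DegLT k (f i)) : DegLT k (fun x => ∑ i ∈ S, f i x) := by
  induction S using Finset.induction_on with
  | empty => simpa using DegLT.zero k
  | insert j S hj ih =>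
    simp only [sum_insert hj]
    exact (hf j (mem_insert_self _ _)).add (ih fun i hi => hf i (mem_insert_of_mem hi))

theorem DegLT.coord_pow_mul {k : ℕ} {f : Cube n → ZMod 2} (hf : DegLT k f) (i : Fin n) (e : ℕ) :
    DegLT (k + e) (fun x => x i ^ e * f x) := by
  induction e with
  | zero => simpa using hf
  | succ e ih =>
    have := ih.affine_mul (LinearMap.proj i : (Fin n → ZMod 2) →ₗ[ZMod 2] ZMod 2) 0
    rw [show (fun x : Cube n => x i ^ (e + 1) * f x) = fun x => (x i + 0) * (x i ^ e * f x) from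
      funext fun x => by ring]
    exact this

theorem degLT_monomial (m : Fin n → ℕ) (c : ZMod 2) (S : Finset (Fin n)) :
    DegLT (1 + ∑ i ∈ S, m i) (fun x : Cube n => c * ∏ i ∈ S, x i ^ m i) := by
  induction S using Finset.induction_on with
  | empty => simpa using DegLT.const c
  | insert j S hj ih =>
    have := ih.coord_pow_mul j (m j)
    rw [sum_insert hj, add_left_comm, add_comm]
    convert this using 2 with x
    rw [prod_insert hj]
    ring

theorem degLT_eval {d : ℕ} {p : MvPolynomial (Fin n) (ZMod 2)} (hp : p.totalDegree ≤ d) :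
    DegLT (d + 1) (fun x : Cube n => MvPolynomial.eval x p) := by
  simp only [MvPolynomial.eval_eq']
  refine DegLT.sum _ fun m hm => (degLT_monomial (fun i => m i) _ univ).mono ?_
  have h1 := (MvPolynomial.le_totalDegree hm).trans hp
  rw [Finsupp.sum_fintype _ _ (fun _ => rfl)] at h1
  omega

/-- One variable is peeled off at a time: f is its value at x_i = 0 plus x_i times its derivative
along e_i at x_i = 0. The alternative `p = 0` serves `k = 0`, as `totalDegree` of zero is 0. -/
theorem exists_polynomial_of_dependsOn (S : Finset (Fin n)) : ∀ (k : ℕ) (f : Cube n → ZMod 2),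
    DegLT k f → (∀ x y : Cube n, (∀ i ∈ S, x i = y i) → f x = f y) →
    ∃ p : MvPolynomial (Fin n) (ZMod 2), (p = 0 ∨ p.totalDegree + 1 ≤ k) ∧
      ∀ x, f x = MvPolynomial.eval x p := by
  induction S using Finset.induction_on with
  | empty =>
    intro k f hf hdep
    cases k with
    | zero => exact ⟨0, Or.inl rfl, fun x => by simpa using hf x⟩
    | succ k =>
      refine ⟨MvPolynomial.C (f 0), Or.inr ?_, fun x => ?_⟩
      · rw [MvPolynomial.totalDegree_C]; omega
      · rw [MvPolynomial.eval_C]; exact hdep _ _ (by simp)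
  | insert i S hi ih =>
    intro k f hf hdep
    cases k with
    | zero => exact ⟨0, Or.inl rfl, fun x => by simpa using hf x⟩
    | succ k =>
      have hπ : ∀ x v : Cube n, Function.update (x + v) i 0 =
          Function.update x i 0 + Function.update v i 0 := by
        intro x v
        funext j
        by_cases hj : j = i
        · subst hj; simp
        · simp [hj]
      have hagree : ∀ x y : Cube n, (∀ j ∈ S, x j = y j) → ∀ j ∈ insert i S,
          Function.update x i 0 j = Function.update y i 0 j := by
        intro x y hxy j hj
        by_cases hji : j = i
        · subst hji; simp
        · simp [hji, hxy j ((mem_insert.1 hj).resolve_left hji)]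
      obtain ⟨p, hp, hpf⟩ := ih (k + 1) (fun x => f (Function.update x i 0))
        (hf.comp (φ := fun x => Function.update x i 0) (L := fun v => Function.update v i 0) hπ)
        (fun x y hxy => hdep _ _ (hagree x y hxy))
      obtain ⟨q, hq, hqf⟩ := ih k (fun x => f (Function.update x i 0 + Pi.single i 1) +
          f (Function.update x i 0))
        ((hf (Pi.single i 1)).comp (φ := fun x => Function.update x i 0)
          (L := fun v => Function.update v i 0) hπ)
        (fun x y hxy => by
          rw [hdep _ _ (hagree x y hxy), hdep (Function.update x i 0 + Pi.single i 1)
            (Function.update y i 0 + Pi.single i 1)]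
          intro j hj
          rw [Pi.add_apply, Pi.add_apply, hagree x y hxy j hj])
      refine ⟨p + MvPolynomial.X i * q, Or.inr ?_, fun x => ?_⟩
      · have h1 : p.totalDegree ≤ k := by
          rcases hp with rfl | hp
          · simp
          · omega
        have h2 : (MvPolynomial.X i * q).totalDegree ≤ k := by
          rcases hq with rfl | hq
          · simp
          · refine (MvPolynomial.totalDegree_mul _ _).trans ?_
            rw [MvPolynomial.totalDegree_X]
            omega
        have := (MvPolynomial.totalDegree_add p (MvPolynomial.X i * q)).trans (max_le h1 h2)
        omega
      · rw [map_add, map_mul, MvPolynomial.eval_X, ← hpf, ← hqf]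
        rcases zmod_two_cases (x i) with h | h
        · rw [h, zero_mul, add_zero, ← h, Function.update_eq_self]
        · have : Function.update x i 0 + Pi.single i 1 = x := by
            funext j
            by_cases hj : j = i
            · subst hj; simp [h]
            · simp [hj]
          rw [h, one_mul, this, add_left_comm, CharTwo.add_self_eq_zero, add_zero]

theorem mem_RM_iff {d : ℕ} {f : Cube n → ZMod 2} : f ∈ RM d n ↔ DegLT (d + 1) f := by
  constructor
  · rintro ⟨p, hp, hf⟩
    rw [funext hf]
    exact degLT_eval hp
  · intro hf
    obtain ⟨p, hp, hpf⟩ := exists_polynomial_of_dependsOn univ (d + 1) f hf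
      (fun x y h => congrArg f (funext fun i => h i (mem_univ i)))
    refine ⟨p, ?_, hpf⟩
    rcases hp with rfl | hp
    · simp
    · omega

theorem relDist_eq (f g : Cube n → ZMod 2) :
    relDist f g = ((univ.filter fun x => f x ≠ g x).card : ℝ) / (Fintype.card (Cube n) : ℝ) := by
  unfold relDist prob
  rw [Nat.card_eq_fintype_card, Nat.card_eq_fintype_card, Fintype.card_subtype]

theorem relDist_nonneg (f g : Cube n → ZMod 2) : 0 ≤ relDist f g := by
  rw [relDist_eq]; positivity

theorem relDist_ge_of_mem_RM {d : ℕ} {f g : Cube n → ZMod 2} (hf : f ∈ RM d n) (hg : g ∈ RM d n)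
    (hne : f ≠ g) : 1 / 2 ^ d ≤ relDist f g := by
  obtain ⟨x, hx⟩ := Function.ne_iff.1 hne
  have h1 := ((mem_RM_iff.1 hf).add (mem_RM_iff.1 hg)).card_le_two_pow_mul
    ⟨x, fun h => hx (CharTwo.add_eq_zero.1 h)⟩
  have h2 : (univ.filter fun x => f x + g x ≠ 0) = univ.filter fun x => f x ≠ g x := by
    refine filter_congr fun x _ => ?_
    rw [ne_eq, CharTwo.add_eq_zero]
  rw [h2] at h1
  have h3 : (Fintype.card (Cube n) : ℝ) ≤ 2 ^ d * ((univ.filter fun x => f x ≠ g x).card : ℝ) := by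
    exact_mod_cast h1
  have hpos : (0 : ℝ) < Fintype.card (Cube n) := by exact_mod_cast Fintype.card_pos
  rw [relDist_eq, div_le_div_iff₀ (by positivity) hpos]
  linarith

theorem zero_mem_RM (d n : ℕ) : (0 : Cube n → ZMod 2) ∈ RM d n := ⟨0, by simp, by simp⟩

/-- The product of `d` coordinates is nonzero only where all of them equal 1. -/
theorem exists_relDist_eq {d : ℕ} (h : d ≤ n) : ∃ f ∈ RM d n, relDist f 0 = 1 / 2 ^ d := by
  refine ⟨fun x => ∏ i : Fin d, x (Fin.castLE h i),
    ⟨∏ i : Fin d, MvPolynomial.X (Fin.castLE h i), ?_, fun x => by simp [map_prod]⟩, ?_⟩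
  · refine (MvPolynomial.totalDegree_finsetProd _ _).trans ?_
    simp [MvPolynomial.totalDegree_X]
  · let φ : Cube n →+ Cube d :=
      { toFun := fun x i => x (Fin.castLE h i)
        map_zero' := rfl
        map_add' := fun _ _ => rfl }
    have hφ : Function.Surjective φ := by
      intro y
      refine ⟨fun j => if hj : j.1 < d then y ⟨j.1, hj⟩ else 0, ?_⟩
      funext i
      change (if hj : (Fin.castLE h i).1 < d then y ⟨(Fin.castLE h i).1, hj⟩ else 0) = y i
      simp
    have h1 := card_mul_sum_comp φ hφ (fun y => if y = fun _ => 1 then 1 else 0)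
    rw [sum_ite_eq' univ (fun _ => 1), if_pos (mem_univ _), mul_one] at h1
    have h2 : ((univ.filter fun x : Cube n =>
        (∏ i : Fin d, x (Fin.castLE h i)) ≠ (0 : Cube n → ZMod 2) x).card : ℝ) =
        ∑ a, if φ a = fun _ => 1 then (1 : ℝ) else 0 := by
      rw [card_filter]
      push_cast
      refine sum_congr rfl fun x _ => if_congr ?_ rfl rfl
      rw [Pi.zero_apply, prod_ne_zero_iff]
      constructor
      · intro hx
        funext i
        exact (zmod_two_cases _).resolve_left (hx i (mem_univ i))
      · intro hx i _
        have := congrFun hx i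
        change x (Fin.castLE h i) = 1 at this
        rw [this]
        decide
    rw [relDist_eq, h2, ← h1]
    have hS : (∑ a, if φ a = fun _ => 1 then (1 : ℝ) else 0) ≠ 0 := by
      intro h0
      rw [h0, mul_zero] at h1
      exact Fintype.card_ne_zero (α := Cube n) (by exact_mod_cast h1.symm)
    have hc : (Fintype.card (Cube d) : ℝ) = 2 ^ d := by simp [ZMod.card]
    rw [hc]
    field_simp

theorem minDist_RM {d : ℕ} (h : d ≤ n) : minDist (RM d n) = 1 / 2 ^ d := by
  refine IsLeast.csInf_eq ⟨?_, ?_⟩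
  · obtain ⟨f, hf, hd⟩ := exists_relDist_eq h
    refine ⟨f, hf, 0, zero_mem_RM d n, ?_, hd.symm⟩
    rintro rfl
    have h0 : relDist (0 : Cube n → ZMod 2) 0 = 0 := by simp [relDist_eq]
    rw [h0] at hd
    have : (0 : ℝ) < 1 / 2 ^ d := by positivity
    linarith
  · rintro _ ⟨f, hf, g, hg, hne, rfl⟩
    exact relDist_ge_of_mem_RM hf hg hne

theorem distTo_le {d : ℕ} (f : Cube n → ZMod 2) {g : Cube n → ZMod 2} (hg : g ∈ RM d n) :
    distTo f (RM d n) ≤ relDist f g :=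
  csInf_le ⟨0, by rintro _ ⟨g, _, rfl⟩; exact relDist_nonneg f g⟩ ⟨g, hg, rfl⟩

theorem exists_relDist_eq_distTo (d : ℕ) (f : Cube n → ZMod 2) :
    ∃ g ∈ RM d n, relDist f g = distTo f (RM d n) := by
  have hfin : {δ : ℝ | ∃ g ∈ RM d n, δ = relDist f g}.Finite := by
    refine (Set.finite_range (fun g : Cube n → ZMod 2 => relDist f g)).subset ?_
    rintro _ ⟨g, _, rfl⟩
    exact ⟨g, rfl⟩
  have hne : {δ : ℝ | ∃ g ∈ RM d n, δ = relDist f g}.Nonempty := ⟨_, 0, zero_mem_RM d n, rfl⟩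
  obtain ⟨g, hg, h⟩ := hne.csInf_mem hfin
  exact ⟨g, hg, h.symm⟩

theorem far_of_distTo_ge {d : ℕ} {f : Cube n → ZMod 2}
    (h : 1 / 32 * (1 / 2 ^ d) ≤ distTo f (RM d n)) : Far d f := by
  intro p hp
  have h1 := h.trans (distTo_le f (mem_RM_iff.2 hp))
  have hpos : (0 : ℝ) < Fintype.card (Cube n) := by exact_mod_cast Fintype.card_pos
  rw [relDist_eq, one_div_mul_one_div, div_le_div_iff₀ (by positivity) hpos] at h1
  have h2 : (Fintype.card (Cube n) : ℝ) ≤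
      32 * 2 ^ d * ((univ.filter fun x => f x ≠ p x).card : ℝ) := by linarith
  exact_mod_cast h2

end Polynomials

/-! ### Uniform probability and independent repetition. -/

section Probability

theorem prob_comp {Ω Ω' : Type} [Finite Ω] [Finite Ω'] (φ : Ω' → Ω) {c : ℕ} (hc : c ≠ 0)
    (hφ : ∀ ω, Nat.card {ω' // φ ω' = ω} = c) (E : Ω → Prop) :
    prob E = prob (fun ω' => E (φ ω')) := by
  have := Fintype.ofFinite Ω
  have h1 : Nat.card {ω' // E (φ ω')} = Nat.card {ω // E ω} * c := by
    have e : {ω' // E (φ ω')} ≃ Σ ω : {ω // E ω}, {ω' // φ ω' = ω.1} :=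
      { toFun := fun ω' => ⟨⟨φ ω'.1, ω'.2⟩, ω'.1, rfl⟩
        invFun := fun z => ⟨z.2.1, by rw [z.2.2]; exact z.1.2⟩
        left_inv := fun _ => rfl
        right_inv := by rintro ⟨⟨ω, _⟩, ω', h⟩; obtain rfl : φ ω' = ω := h; rfl }
    rw [Nat.card_congr e, Nat.card_sigma]
    simp [hφ]
  have h2 : Nat.card Ω' = Nat.card Ω * c := by
    rw [← Nat.card_congr (Equiv.sigmaFiberEquiv φ), Nat.card_sigma]
    simp [hφ]
  unfold prob
  rw [h1, h2]
  push_cast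
  rw [mul_div_mul_right]
  exact_mod_cast hc

theorem prob_nonneg {Ω : Type} (E : Ω → Prop) : 0 ≤ prob E := by
  unfold prob; positivity

theorem prob_not {Ω : Type} [Finite Ω] [Nonempty Ω] (E : Ω → Prop) :
    prob (fun ω => ¬ E ω) = 1 - prob E := by
  have := Fintype.ofFinite Ω
  have hpos : (0 : ℝ) < Fintype.card Ω := by exact_mod_cast Fintype.card_pos
  unfold prob
  simp only [Nat.card_eq_fintype_card]
  rw [eq_sub_iff_add_eq, ← add_div, div_eq_one_iff_eq hpos.ne', Fintype.card_subtype,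
    Fintype.card_subtype, ← card_univ, add_comm]
  exact_mod_cast card_filter_add_card_filter_not (s := (univ : Finset Ω)) E

theorem prob_forall {Ω : Type} [Finite Ω] (r : ℕ) (E : Ω → Prop) :
    prob (fun ω : Fin r → Ω => ∀ i, E (ω i)) = prob E ^ r := by
  unfold prob
  rw [Nat.card_congr (Equiv.subtypePiEquivPi (p := fun (_ : Fin r) ω => E ω)), Nat.card_pi, Nat.card_pi]
  simp [div_pow]

theorem Tester.rejectProb_eq {n : ℕ} (T : Tester n) (f : Cube n → ZMod 2) :
    T.rejectProb f = 1 - T.acceptProb f := by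
  have := T.finite_coins
  have := T.nonempty_coins
  exact prob_not _

theorem Tester.acceptProb_rep {n : ℕ} (T : Tester n) (r : ℕ) (f : Cube n → ZMod 2) :
    (T.rep r).acceptProb f = T.acceptProb f ^ r := by
  have := T.finite_coins
  exact prob_forall r (fun ω => T.AcceptsOn f ω)

theorem Tester.queriesAtMost_rep {n q : ℕ} {T : Tester n} (hT : T.QueriesAtMost q) (r : ℕ) :
    (T.rep r).QueriesAtMost (r * q) := by
  intro ω
  change (⋃ i, T.queries (ω i)).ncard ≤ r * q
  refine (Set.ncard_iUnion_le_of_fintype _).trans ?_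
  refine (sum_le_sum fun i _ => hT (ω i)).trans ?_
  simp

end Probability

/-! ### Random flats through random frames. -/

section Flats

variable {n k : ℕ}

/-- Frames: a base point with linearly independent directions. -/
abbrev Frame (n k : ℕ) : Type :=
  Cube n × {v : Fin k → Cube n // LinearIndependent (ZMod 2) v}

/-- The flat spanned by a frame. -/
noncomputable def Frame.flat (ω : Frame n k) : Flat n k :=
  ⟨AffineSubspace.mk' ω.1 (Submodule.span (ZMod 2) (Set.range ω.2.1)), ⟨ω.1, by simp⟩, by
    rw [AffineSubspace.direction_mk', finrank_span_eq_card ω.2.2, Fintype.card_fin]⟩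

theorem Frame.mem_flat {ω : Frame n k} {x : Cube n} :
    x ∈ ω.flat.1 ↔ ∃ t : Fin k → ZMod 2, x = ω.1 + ∑ i, t i • ω.2.1 i := by
  change x ∈ AffineSubspace.mk' ω.1 (Submodule.span (ZMod 2) (Set.range ω.2.1)) ↔ _
  rw [AffineSubspace.mem_mk', Submodule.mem_span_range_iff_exists_fun]
  simp only [vsub_eq_sub, eq_sub_iff_add_eq]
  exact exists_congr fun t => by rw [eq_comm, add_comm]

theorem Frame.flat_eq_iff {ω : Frame n k} {A : Flat n k} :
    ω.flat = A ↔ ω.1 ∈ A.1 ∧ ∀ i, ω.2.1 i ∈ A.1.direction := by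
  constructor
  · rintro rfl
    refine ⟨by simp [Frame.flat], fun i => ?_⟩
    simp only [Frame.flat, AffineSubspace.direction_mk']
    exact Submodule.subset_span ⟨i, rfl⟩
  · rintro ⟨h1, h2⟩
    refine Subtype.ext ?_
    have h3 : Submodule.span (ZMod 2) (Set.range ω.2.1) = A.1.direction := by
      refine Submodule.eq_of_le_of_finrank_eq ?_ ?_
      · rw [Submodule.span_le]
        rintro _ ⟨i, rfl⟩
        exact h2 i
      · rw [finrank_span_eq_card ω.2.2, Fintype.card_fin, A.2.2]
    simp only [Frame.flat, h3]
    exact AffineSubspace.mk'_eq h1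

theorem card_flat_points (A : Flat n k) : Nat.card A.1 = 2 ^ k := by
  obtain ⟨a, ha⟩ := A.2.1
  have e : A.1 ≃ A.1.direction :=
    { toFun := fun x => ⟨x.1 -ᵥ a, AffineSubspace.vsub_mem_direction x.2 ha⟩
      invFun := fun v => ⟨v.1 +ᵥ a, AffineSubspace.vadd_mem_of_mem_direction v.2 ha⟩
      left_inv := fun x => by simp
      right_inv := fun v => by simp }
  rw [Nat.card_congr e, Nat.card_eq_fintype_card, card_eq_two_pow, A.2.2]

theorem card_frames_of_flat (A : Flat n k) :
    Nat.card {ω : Frame n k // ω.flat = A} = 2 ^ k * ∏ i : Fin k, (2 ^ k - 2 ^ i.1) := by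
  have e : {ω : Frame n k // ω.flat = A} ≃
      A.1 × {w : Fin k → A.1.direction // LinearIndependent (ZMod 2) w} :=
    { toFun := fun ω => (⟨ω.1.1, (Frame.flat_eq_iff.1 ω.2).1⟩,
        ⟨fun i => ⟨ω.1.2.1 i, (Frame.flat_eq_iff.1 ω.2).2 i⟩,
          LinearIndependent.of_comp A.1.direction.subtype ω.1.2.2⟩)
      invFun := fun z => ⟨(z.1.1, ⟨fun i => (z.2.1 i).1,
          z.2.2.map' A.1.direction.subtype (Submodule.ker_subtype _)⟩),
        Frame.flat_eq_iff.2 ⟨z.1.2, fun i => (z.2.1 i).2⟩⟩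
      left_inv := fun _ => rfl
      right_inv := fun _ => rfl }
  rw [Nat.card_congr e, Nat.card_prod, card_flat_points,
    card_linearIndependent (K := ZMod 2) (V := A.1.direction) (k := k) A.2.2.ge, A.2.2, ZMod.card]

/-- All flats have equally many frames, so a uniform frame spans a uniform flat. -/
theorem prob_flat (E : Flat n k → Prop) : prob E = prob (fun ω : Frame n k => E ω.flat) := by
  have hfin : Finite (Frame n k) := inferInstance
  refine prob_comp Frame.flat (c := 2 ^ k * ∏ i : Fin k, (2 ^ k - 2 ^ i.1)) ?_
    card_frames_of_flat E
  refine mul_ne_zero (by positivity) (prod_ne_zero_iff.2 fun i _ => ?_)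
  have := Nat.pow_lt_pow_right (a := 2) (by norm_num) i.2
  omega

theorem flatTest_rejectProb {d : ℕ} (h : k ≤ n) (f : Cube n → ZMod 2) :
    (flatTest d h).rejectProb f = prob (fun ω : Frame n k =>
      ¬ IsPolyOn d (ω.flat.1 : Set (Cube n)) (fun x => f x.1)) := by
  rw [← prob_flat (fun A : Flat n k => ¬ IsPolyOn d (A.1 : Set (Cube n)) (fun x => f x.1))]
  rfl

theorem cubeSum_eq_zero_of_isPolyOn {d : ℕ} {f : Cube n → ZMod 2} (ω : Frame n (d + 1))
    (h : IsPolyOn d (ω.flat.1 : Set (Cube n)) (fun x => f x.1)) : cubeSum f ω.1 ω.2.1 = 0 := by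
  obtain ⟨p, hp, hf⟩ := h
  rw [← degLT_iff_cubeSum.1 (degLT_eval hp) ω.1 ω.2.1]
  exact sum_congr rfl fun t _ => hf ⟨_, Frame.mem_flat.2 ⟨t, rfl⟩⟩

/-- A nonzero sum forces independent edges and certifies rejection on the spanned flat; frames are
no more numerous than parallelepipeds, which only helps. -/
theorem rej_le_rejectProb {d : ℕ} (h : d + 1 ≤ n) (f : Cube n → ZMod 2) :
    rej (d + 1) f ≤ (TGN h).rejectProb f := by
  rw [TGN, flatTest_rejectProb]
  unfold prob rej
  have h1 : rejCount (d + 1) f ≤ (Nat.card {ω : Frame n (d + 1) //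
      ¬ IsPolyOn d (ω.flat.1 : Set (Cube n)) (fun x => f x.1)} : ℝ) := by
    rw [Nat.card_eq_fintype_card, Fintype.card_subtype]
    have e : rejCount (d + 1) f = ((univ.filter fun z : Cube n × (Fin (d + 1) → Cube n) =>
        cubeSum f z.1 z.2 ≠ 0).card : ℝ) := by
      rw [card_filter, Fintype.sum_prod_type]
      push_cast
      refine sum_congr rfl fun a _ => sum_congr rfl fun v _ => ?_
      unfold ind
      split_ifs <;> simp_all
    rw [e]
    have hli : ∀ z : Cube n × (Fin (d + 1) → Cube n), cubeSum f z.1 z.2 ≠ 0 →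
        LinearIndependent (ZMod 2) z.2 := fun z hz => by
      by_contra hv
      exact hz (cubeSum_eq_zero_of_not_linearIndependent f z.1 hv)
    have : (univ.filter fun z : Cube n × (Fin (d + 1) → Cube n) => cubeSum f z.1 z.2 ≠ 0).card ≤
        (univ.filter fun ω : Frame n (d + 1) =>
          ¬ IsPolyOn d (ω.flat.1 : Set (Cube n)) (fun x => f x.1)).card := by
      refine card_le_card_of_surjOn (fun ω : Frame n (d + 1) => (ω.1, ω.2.1)) ?_
      intro z hz
      have hz' := (mem_filter.1 (mem_coe.1 hz)).2
      refine ⟨(z.1, ⟨z.2, hli z hz'⟩), mem_coe.2 (mem_filter.2 ⟨mem_univ _, ?_⟩), rfl⟩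
      exact fun hp => hz' (cubeSum_eq_zero_of_isPolyOn (z.1, ⟨z.2, hli z hz'⟩) hp)
    exact_mod_cast this
  have h2 : (Nat.card (Frame n (d + 1)) : ℝ) ≤ (Fintype.card (Cube n) : ℝ) ^ (d + 1 + 1) := by
    have : Nat.card (Frame n (d + 1)) ≤ Fintype.card (Cube n) ^ (d + 1 + 1) := by
      rw [Nat.card_prod, pow_succ', Nat.card_eq_fintype_card, Nat.card_eq_fintype_card]
      refine Nat.mul_le_mul_left _ ((Fintype.card_subtype_le _).trans ?_)
      simp
    exact_mod_cast this
  have h3 : (0 : ℝ) < Nat.card (Frame n (d + 1)) := by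
    have : Nonempty (Frame n (d + 1)) := by
      obtain ⟨b, hb⟩ : ∃ b : Fin (d + 1) → Cube n, LinearIndependent (ZMod 2) b :=
        ⟨_, (Pi.basisFun (ZMod 2) (Fin n)).linearIndependent.comp _ (Fin.castLE_injective h)⟩
      exact ⟨(0, ⟨b, hb⟩)⟩
    exact_mod_cast Nat.card_pos
  exact div_le_div₀ (by positivity) h1 h3 h2

theorem rejectProb_le {d : ℕ} (h : d + 1 ≤ n) (f : Cube n → ZMod 2) {g : Cube n → ZMod 2}
    (hg : g ∈ RM d n) : (TGN h).rejectProb f ≤ 2 ^ (d + 1) * relDist f g := by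
  rw [TGN, flatTest_rejectProb, relDist_eq]
  unfold prob
  set L := {v : Fin (d + 1) → Cube n // LinearIndependent (ZMod 2) v}
  have h1 : Nat.card {ω : Frame n (d + 1) //
      ¬ IsPolyOn d (ω.flat.1 : Set (Cube n)) (fun x => f x.1)} ≤
      2 ^ (d + 1) * (univ.filter fun x => f x ≠ g x).card * Fintype.card L := by
    rw [Nat.card_eq_fintype_card, Fintype.card_subtype]
    -- A rejecting frame has a corner where `f` and `g` differ; it is recovered from the index of
    -- the corner, that point and the directions.
    have hsub : (univ.filter fun ω : Frame n (d + 1) =>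
        ¬ IsPolyOn d (ω.flat.1 : Set (Cube n)) (fun x => f x.1)) ⊆
        ((univ : Finset (Fin (d + 1) → ZMod 2)) ×ˢ
          ((univ.filter fun x => f x ≠ g x) ×ˢ (univ : Finset L))).image
          fun z => ((z.2.1 - ∑ i, z.1 i • z.2.2.1 i, z.2.2) : Frame n (d + 1)) := by
      intro ω hω
      have hω' := (mem_filter.1 hω).2
      obtain ⟨t, ht⟩ : ∃ t : Fin (d + 1) → ZMod 2,
          f (ω.1 + ∑ i, t i • ω.2.1 i) ≠ g (ω.1 + ∑ i, t i • ω.2.1 i) := by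
        by_contra! hall
        obtain ⟨p, hp, hpg⟩ := hg
        refine hω' ⟨p, hp, fun x => ?_⟩
        obtain ⟨t, ht⟩ := Frame.mem_flat.1 x.2
        change f x.1 = _
        rw [← hpg, ht, hall t]
      exact mem_image.2 ⟨(t, (ω.1 + ∑ i, t i • ω.2.1 i, ω.2)), by simp [ht], by simp⟩
    refine (card_le_card hsub).trans (card_image_le.trans ?_)
    rw [card_product, card_product, card_univ, card_univ, mul_assoc]
    simp [ZMod.card]
  have h2 : Nat.card (Frame n (d + 1)) = Fintype.card (Cube n) * Fintype.card L := by
    rw [Nat.card_prod, Nat.card_eq_fintype_card, Nat.card_eq_fintype_card]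
  have hL : (Fintype.card L : ℝ) ≠ 0 := by
    have : Nonempty L :=
      ⟨⟨_, (Pi.basisFun (ZMod 2) (Fin n)).linearIndependent.comp _ (Fin.castLE_injective h)⟩⟩
    exact_mod_cast Fintype.card_ne_zero
  rw [h2]
  calc _ ≤ ((2 ^ (d + 1) * (univ.filter fun x => f x ≠ g x).card * Fintype.card L : ℕ) : ℝ) /
        ((Fintype.card (Cube n) * Fintype.card L : ℕ) : ℝ) := by
        gcongr
    _ = _ := by
        push_cast
        rw [mul_div_mul_right _ _ hL, mul_div_assoc]

theorem queriesAtMost_TGN {d : ℕ} (h : d + 1 ≤ n) : (TGN h).QueriesAtMost (2 ^ (d + 1)) := by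
  intro A
  exact (card_flat_points A).le

end Flats

end RMTest

/-! ### Choice of the constants. -/

theorem theorem3 :
    ∃ (r : ℕ) (c₁ c₂ : ℝ), 0 < r ∧ 0 < c₁ ∧ 0 < c₂ ∧
      ∀ (d n : ℕ) (h : d + 1 ≤ n),
        RMTest.minDist (RMTest.RM d n) = 1 / 2 ^ d ∧
        ((RMTest.TGN h).rep r).QueriesAtMost (r * 2 ^ (d + 1)) ∧
        ((RMTest.TGN h).rep r).IsTolerant (RMTest.RM d n) c₁ c₂ := by
  obtain ⟨r, hr⟩ := exists_pow_lt_of_lt_one (show (0 : ℝ) < 1 / 3 by norm_num)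
    (show (1 : ℝ) - (1 / 4) ^ 9 < 1 by norm_num)
  have hr0 : 0 < r := by
    rcases Nat.eq_zero_or_pos r with rfl | h
    · norm_num at hr
    · exact h
  have hrR : (0 : ℝ) < r := by exact_mod_cast hr0
  -- With c₁ = 1/(6r) one round rejects with probability at most 1/(3r), and Bernoulli's inequality
  -- gives 2/3 over `r` rounds. The value 1/32 is the constant in `Far`.
  refine ⟨r, 1 / (6 * r), 1 / 32, hr0, by positivity, by norm_num, fun d n h => ?_⟩
  have hmin := RMTest.minDist_RM (n := n) (d := d) (by omega)
  refine ⟨hmin, RMTest.Tester.queriesAtMost_rep (RMTest.queriesAtMost_TGN h) r, fun f => ?_⟩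
  rw [hmin, RMTest.Tester.rejectProb_eq, RMTest.Tester.acceptProb_rep]
  have hacc := RMTest.Tester.rejectProb_eq (RMTest.TGN h) f
  have hnn : 0 ≤ (RMTest.TGN h).acceptProb f := RMTest.prob_nonneg _
  constructor
  · intro hclose
    obtain ⟨g, hg, hdist⟩ := RMTest.exists_relDist_eq_distTo d f
    have h1 := RMTest.rejectProb_le h f hg
    have h2 : (2 : ℝ) ^ (d + 1) * RMTest.relDist f g ≤ 1 / (3 * r) := by
      rw [hdist]
      calc _ ≤ (2 : ℝ) ^ (d + 1) * (1 / (6 * r) * (1 / 2 ^ d)) := by gcongr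
        _ = 1 / (3 * r) := by rw [pow_succ]; field_simp; norm_num
    have h3 : 1 - 1 / (3 * r) ≤ (RMTest.TGN h).acceptProb f := by linarith
    have h4 : (1 : ℝ) / (3 * r) ≤ 1 := by
      rw [div_le_one (by positivity)]
      have : (1 : ℝ) ≤ r := by exact_mod_cast hr0
      linarith
    have h5 := one_add_mul_le_pow (a := -(1 / (3 * (r : ℝ)))) (by linarith) r
    have h6 : 1 + (r : ℝ) * -(1 / (3 * (r : ℝ))) = 2 / 3 := by field_simp; norm_num
    rw [h6] at h5
    refine h5.trans (pow_le_pow_left₀ (by linarith) (by linarith) r)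
  · intro hfar
    have h1 := RMTest.rej_ge_of_far (V := RMTest.Cube n) (by simpa using h)
      (RMTest.far_of_distTo_ge hfar)
    have h2 := RMTest.rej_le_rejectProb h f
    have h3 := pow_le_pow_left₀ hnn
      (show (RMTest.TGN h).acceptProb f ≤ 1 - (1 / 4) ^ 9 by linarith) r
    linarith
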